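/- Let $n\ge 2$ and let $H_n=\mathbb R^{2n+1}=\{(z,t): z=x+iy\in\mathbb C^n,\ t\in\mathbb R\}$ be the Heisenberg group with contact form $\Theta=dt+\sum_j(x_j\,dy_j-y_j\,dx_j)$, contact structure $\xi=\ker\Theta$, orthonormal (Levi metric) horizontal frame $X_j=\partial_{x_j}+y_j\partial_t$, $Y_j=\partial_{y_j}-x_j\partial_t$, CR structure $JX_j=Y_j$, $JY_j=-X_j$, $T=\partial_t$, and the pseudohermitian connection $\nabla$, for which all $X_j,Y_j,T$ are parallel. Let $\Sigma$ be an immersed $C^2$ hypersurface of $H_n$ whose regular part (the points where $T\Sigma\ne\xi$) is $C^\infty$. At a regular point put $\xi'=(\xi\cap T\Sigma)\cap J(\xi\cap T\Sigma)$, let $e_n\in\xi\cap T\Sigma$ be a unit vector orthogonal to $\xi'$, let $e_{2n}=Je_n$ be the horizontal normal, and let $\alpha$ be the function with $\alpha e_{2n}+T\in T\Sigma$. Let $J'$ be $J$ on $\xi'$ with $J'e_n=0$, let $\mathfrak S(v)=-\nabla_v e_{2n}+\alpha J'v$ be the shape operator on $\xi\cap T\Sigma$, and let $l=\langle-\nabla_{e_n}e_{2n},e_n\rangle$.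 A regular point is umbilic if $\mathfrak S(\xi')\subset\xi'$ and all eigenvalues of $\mathfrak S|_{\xi'}$ are equal, to $k$ say; $\Sigma$ is umbilic if all its regular points are. For $\lambda>0$ the Pansu sphere $S_\lambda$ is the union of the graphs of $f$ and $-f$, where $$f(z)=\frac1{2\lambda^2}\Big(\lambda|z|\sqrt{1-\lambda^2|z|^2}+\cos^{-1}(\lambda|z|)\Big),\qquad |z|\le\frac1\lambda .$$ **Proposition 3.1.** Suppose that $\Sigma$ is rotationally symmetric, i.e. (the image of) $\Sigma$ is invariant under the maps $(z,t)\mapsto(Uz,t)$, $U\in U(n)$. Then $\Sigma$ is umbilic. If, in addition, $\Sigma$ is closed (compact without boundary), connected, and satisfies $l=2k$ at all regular points, then there are $\lambda>0$ and $c\in\mathbb R$ such that $\Sigma$ is embedded and is the Pansu sphere $S_\lambda$ translated by $c$ along the $t$-axis, and $k=\lambda$ at every regular point with respect to the inward horizontal normal $e_{2n}$. If moreover $\Sigma$ is invariant under $(z,t)\mapsto(z,-t)$, then $\Sigma=S_\lambda$. -/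

import Mathlib

open scoped ContDiff Topology

noncomputable section

/-! ## The Heisenberg group

A point `(x₁, …, xₙ, y₁, …, yₙ, t)` of `Hₙ = ℝ²ⁿ⁺¹` is written `(z, t)` with `zⱼ = xⱼ + i yⱼ`.
-/

/-- `ℂⁿ = ℝ²ⁿ`.  A vector `a` also encodes the coefficients of a horizontal vector in the left
invariant frame `X₁, …, Xₙ, Y₁, …, Yₙ`, the coefficient of `Xⱼ` being `Re aⱼ` and that of `Yⱼ`
being `Im aⱼ`. -/
abbrev CVec (n : ℕ) : Type := EuclideanSpace ℂ (Fin n)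

/-- The underlying space of the Heisenberg group `Hₙ`. -/
abbrev Heis (n : ℕ) : Type := CVec n × ℝ

namespace Heis

variable {n : ℕ}

/-- The contact form `Θ = dt + ∑ (xⱼ dyⱼ - yⱼ dxⱼ)` at the point `q`. -/
def contactForm (q : Heis n) : Heis n →ₗ[ℝ] ℝ where
  toFun v := v.2 + ∑ j, ((q.1 j).re * (v.1 j).im - (q.1 j).im * (v.1 j).re)
  map_add' v w := by
    have h : ∀ j, ((q.1 j).re * ((v + w).1 j).im - (q.1 j).im * ((v + w).1 j).re)
        = ((q.1 j).re * (v.1 j).im - (q.1 j).im * (v.1 j).re)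
          + ((q.1 j).re * (w.1 j).im - (q.1 j).im * (w.1 j).re) := by
      intro j; simp; ring
    simp only [h, Finset.sum_add_distrib, Prod.snd_add]; ring
  map_smul' c v := by
    have h : ∀ j, ((q.1 j).re * ((c • v).1 j).im - (q.1 j).im * ((c • v).1 j).re)
        = c * ((q.1 j).re * (v.1 j).im - (q.1 j).im * (v.1 j).re) := by
      intro j; simp; ring
    simp only [h, ← Finset.mul_sum, Prod.smul_snd, smul_eq_mul, RingHom.id_apply]; ring

/-- The contact structure `ξ = ker Θ` at the point `q`. -/
def contactPlane (q : Heis n) : Submodule ℝ (Heis n) := LinearMap.ker (contactForm q)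

/-- The horizontal vector `∑ (Re aⱼ) Xⱼ + (Im aⱼ) Yⱼ` at the point `q`, where
`Xⱼ = ∂/∂xⱼ + yⱼ ∂/∂t` and `Yⱼ = ∂/∂yⱼ - xⱼ ∂/∂t`. -/
def hor (q : Heis n) : CVec n →ₗ[ℝ] Heis n where
  toFun a := (a, ∑ j, ((q.1 j).im * (a j).re - (q.1 j).re * (a j).im))
  map_add' a b := by
    refine Prod.ext rfl ?_
    simp only [Prod.snd_add, ← Finset.sum_add_distrib]
    refine Finset.sum_congr rfl fun j _ => ?_
    simp; ring
  map_smul' c a := by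
    refine Prod.ext rfl ?_
    simp only [Prod.smul_snd, smul_eq_mul, Finset.mul_sum, RingHom.id_apply]
    refine Finset.sum_congr rfl fun j _ => ?_
    simp; ring

/-- The horizontal vectors at `q` are exactly the elements of the contact plane. -/
theorem range_hor (q : Heis n) : LinearMap.range (hor q) = contactPlane q := by
  ext v
  simp only [LinearMap.mem_range, contactPlane, LinearMap.mem_ker]
  constructor
  · rintro ⟨a, rfl⟩
    simp [contactForm, hor]
  · intro h
    refine ⟨v.1, Prod.ext rfl ?_⟩
    simp only [contactForm, LinearMap.coe_mk, AddHom.coe_mk, Finset.sum_sub_distrib] at h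
    simp only [hor, LinearMap.coe_mk, AddHom.coe_mk, Finset.sum_sub_distrib]
    linarith

/-- The vector field `T = ∂/∂t`. -/
def vertT : Heis n := (0, 1)

/-- The CR structure `J Xⱼ = Yⱼ`, `J Yⱼ = -Xⱼ`: multiplication of the coefficients by `i`. -/
def J : CVec n →ₗ[ℝ] CVec n where
  toFun a := Complex.I • a
  map_add' a b := smul_add _ a b
  map_smul' c a := smul_comm _ c a

/-- The Levi metric `∑ (dxⱼ² + dyⱼ²)` on horizontal vectors; its norm is the norm of `CVec n`. -/
def levi (a b : CVec n) : ℝ := ∑ j, ((a j).re * (b j).re + (a j).im * (b j).im)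

/-- The pseudohermitian connection of `Hₙ` on horizontal vector fields, `∇_v A`.  It is the
connection for which `X₁, …, Xₙ, Y₁, …, Yₙ` are parallel, so it differentiates the
coefficients `A` of the field along `v`. -/
def nabla (q v : Heis n) (A : Heis n → CVec n) : CVec n := fderiv ℝ A q v

/-! ## Pointwise geometry of a hypersurface `{u = 0}` -/

/-- The tangent space of the hypersurface `{u = 0}` at its point `q`. -/
def tangent (u : Heis n → ℝ) (q : Heis n) : Submodule ℝ (Heis n) :=
  LinearMap.ker (fderiv ℝ u q).toLinearMap

/-- The space `ξ ∩ TΣ`, in terms of coefficients. -/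
def horTangent (u : Heis n → ℝ) (q : Heis n) : Submodule ℝ (CVec n) :=
  (tangent u q).comap (hor q)

/-- The space `ξ' = (ξ ∩ TΣ) ∩ J (ξ ∩ TΣ)`. -/
def xiPrime (u : Heis n → ℝ) (q : Heis n) : Submodule ℝ (CVec n) :=
  horTangent u q ⊓ (horTangent u q).map J

/-- The horizontal gradient `∇_b u = ∑ (Xⱼ u) Xⱼ + (Yⱼ u) Yⱼ`. -/
def hgrad (u : Heis n → ℝ) (q : Heis n) : CVec n :=
  WithLp.toLp 2 fun j => (⟨fderiv ℝ u q (hor q (EuclideanSpace.single j 1)),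
    fderiv ℝ u q (hor q (EuclideanSpace.single j Complex.I))⟩ : ℂ)

/-- The horizontal normal `e₂ₙ = ∇_b u / |∇_b u|`.  Replacing `u` by `-u` reverses it. -/
def e2n (u : Heis n → ℝ) (q : Heis n) : CVec n := (‖hgrad u q‖⁻¹ : ℝ) • hgrad u q

/-- The characteristic direction `eₙ = -J e₂ₙ`, so that `J eₙ = e₂ₙ`. -/
def en (u : Heis n → ℝ) (q : Heis n) : CVec n := -J (e2n u q)

/-- The function `α` for which `α e₂ₙ + T` is tangent to the hypersurface. -/
def alpha (u : Heis n → ℝ) (q : Heis n) : ℝ := -(fderiv ℝ u q vertT) / ‖hgrad u q‖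

/-- The map `J'` with `J' = J` on `ξ'` and `J' eₙ = 0`. -/
def Jprime (u : Heis n → ℝ) (q : Heis n) (a : CVec n) : CVec n :=
  J (a - levi a (en u q) • en u q)

/-- The shape operator `a ↦ -∇_a e₂ₙ + α J' a` on `ξ ∩ TΣ`. -/
def shape (u : Heis n → ℝ) (q : Heis n) (a : CVec n) : CVec n :=
  -nabla q (hor q a) (e2n u) + alpha u q • Jprime u q a

/-- The function `l`, i.e. `-∇_{eₙ} e₂ₙ = l eₙ` modulo `ξ'`. -/
def ell (u : Heis n → ℝ) (q : Heis n) : ℝ :=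
  levi (-nabla q (hor q (en u q)) (e2n u)) (en u q)

/-- `k` is the common eigenvalue of the shape operator on `ξ'`. -/
def IsCommonEigenvalue (u : Heis n → ℝ) (q : Heis n) (k : ℝ) : Prop :=
  ∀ a ∈ xiPrime u q, shape u q a = k • a

/-- Umbilicity at a regular point: `ξ'` is invariant under the shape operator and all the
eigenvalues of the (self-adjoint) restriction coincide. -/
def IsUmbilicAt (u : Heis n → ℝ) (q : Heis n) : Prop :=
  (∀ a ∈ xiPrime u q, shape u q a ∈ xiPrime u q) ∧ ∃ k : ℝ, IsCommonEigenvalue u q k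

/-! ### The frame has the defining properties -/

theorem levi_hgrad (u : Heis n → ℝ) (q : Heis n) (a : CVec n) :
    levi (hgrad u q) a = fderiv ℝ u q (hor q a) := by
  have ha : a = ∑ j, ((a j).re • EuclideanSpace.single j (1 : ℂ)
      + (a j).im • EuclideanSpace.single j Complex.I) := by
    ext i
    simp [Finset.sum_apply, Pi.single_apply, Finset.sum_add_distrib]
  conv_rhs => rw [ha]
  simp only [map_sum, map_add, map_smul, levi, hgrad, smul_eq_mul]
  exact Finset.sum_congr rfl fun j _ => by ring

theorem levi_self (a : CVec n) : levi a a = ‖a‖ ^ 2 := by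
  rw [EuclideanSpace.norm_sq_eq]
  refine Finset.sum_congr rfl fun j _ => ?_
  rw [← Complex.normSq_eq_norm_sq, Complex.normSq_apply]

theorem levi_J_self (a : CVec n) : levi a (J a) = 0 :=
  Finset.sum_eq_zero fun j _ => by simp [J]; ring

/-- At a regular point, `|eₙ| = 1`, `eₙ` lies in `ξ ∩ TΣ` and is orthogonal to `ξ'`, and
`α e₂ₙ + T` is tangent. -/
theorem frame_spec (u : Heis n → ℝ) (q : Heis n) (h : hgrad u q ≠ 0) :
    ‖en u q‖ = 1 ∧ J (en u q) = e2n u q ∧ en u q ∈ horTangent u q ∧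
      (∀ a ∈ xiPrime u q, levi (en u q) a = 0) ∧
      alpha u q • hor q (e2n u q) + vertT ∈ tangent u q := by
  have hn : ‖hgrad u q‖ ≠ 0 := norm_ne_zero_iff.mpr h
  have hJJ : ∀ a : CVec n, J (J a) = -a := fun a => by simp [J, smul_smul]
  refine ⟨?_, ?_, ?_, ?_, ?_⟩
  · have : ‖e2n u q‖ = 1 := by
      rw [e2n, norm_smul, norm_inv, norm_norm, inv_mul_cancel₀ hn]
    simpa [en, J, norm_smul] using this
  · rw [en, map_neg, hJJ, neg_neg]
  · simp only [horTangent, tangent, Submodule.mem_comap, LinearMap.mem_ker,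
      ContinuousLinearMap.coe_coe]
    simp only [en, e2n, map_neg, map_smul, ← levi_hgrad, levi_J_self, smul_zero, neg_zero]
  · rintro a ⟨-, b, hb, rfl⟩
    have hb' : levi (hgrad u q) b = 0 := by
      rw [levi_hgrad]; exact hb
    have : levi (en u q) (J b) = -(‖hgrad u q‖⁻¹ * levi (hgrad u q) b) := by
      simp only [levi, Finset.mul_sum, ← Finset.sum_neg_distrib]
      refine Finset.sum_congr rfl fun j _ => ?_
      simp [en, e2n, J]; ring
    rw [this, hb']; simp
  · simp only [tangent, LinearMap.mem_ker, ContinuousLinearMap.coe_coe]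
    rw [e2n, map_add, map_smul, map_smul, map_smul, ← levi_hgrad, levi_self, alpha]
    simp only [smul_eq_mul]
    field_simp
    ring

/-! ## Immersed hypersurfaces -/

variable {M : Type*} [TopologicalSpace M]

/-- `u` is a local defining function of class `Cᵐ` for `φ : M → Hₙ` near `p`: on a neighbourhood
of `p`, the map `φ` is a homeomorphism onto the zero set of `u` in an open set, on which `u` is
`Cᵐ` with nowhere vanishing differential. -/
def IsDefiningAt (m : WithTop ℕ∞) (φ : M → Heis n) (p : M) (u : Heis n → ℝ) : Prop :=
  ∃ (V : Set M) (W : Set (Heis n)), IsOpen V ∧ p ∈ V ∧ IsOpen W ∧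
    ContDiffOn ℝ m u W ∧ (∀ q ∈ W, fderiv ℝ u q ≠ 0) ∧
    Topology.IsEmbedding (fun x : V => φ x) ∧ φ '' V = {q ∈ W | u q = 0}

/-- `p` is a regular point: the tangent space at `p` differs from the contact plane.  (The
tangent space does not depend on the defining function.) -/
def IsRegular (φ : M → Heis n) (p : M) : Prop :=
  ∃ u : Heis n → ℝ, IsDefiningAt 2 φ p u ∧ tangent u (φ p) ≠ contactPlane (φ p)

/-- `φ : M → Hₙ` is an immersed `C²` hypersurface whose regular part is `C^∞`. -/
structure IsImmersedHypersurface (φ : M → Heis n) : Prop where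
  exists_defining : ∀ p, ∃ u : Heis n → ℝ, IsDefiningAt 2 φ p u
  exists_smooth_defining : ∀ p, IsRegular φ p → ∃ u : Heis n → ℝ, IsDefiningAt ∞ φ p u

/-- All regular points are umbilic.  (The notion does not depend on the defining function.) -/
def IsUmbilic (φ : M → Heis n) : Prop :=
  ∀ p, IsRegular φ p → ∀ u : Heis n → ℝ, IsDefiningAt ∞ φ p u → IsUmbilicAt u (φ p)

/-- The condition `l = 2k` on the regular part.  (Replacing `u` by `-u` changes the signs of
both `l` and `k`.) -/
def LEqTwoK (φ : M → Heis n) : Prop :=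
  ∀ p, IsRegular φ p → ∀ u : Heis n → ℝ, IsDefiningAt ∞ φ p u →
    ∀ k : ℝ, IsCommonEigenvalue u (φ p) k → ell u (φ p) = 2 * k

/-- Rotational symmetry: invariance under `(z, t) ↦ (U z, t)` for every `U ∈ U(n)`.  As `U(n)` is
transitive on the spheres `|z| = r`, this is the same as invariance under all rotations of
`ℝ²ⁿ`, or as being described by a condition on `(|z|, t)`. -/
def IsRotationallySymmetric (φ : M → Heis n) : Prop :=
  ∀ U : CVec n ≃ₗᵢ[ℂ] CVec n, ∀ q ∈ Set.range φ, (U q.1, q.2) ∈ Set.range φ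

/-! ## Pansu spheres -/

/-- The profile function of the Pansu sphere, as a function of `r = |z|`. -/
def pansuProfile (lam r : ℝ) : ℝ :=
  1 / (2 * lam ^ 2) * (lam * r * Real.sqrt (1 - lam ^ 2 * r ^ 2) + Real.arccos (lam * r))

/-- The Pansu sphere `S_λ`: the union of the graphs of `f` and `-f` over `|z| ≤ 1 / λ`. -/
def pansuSphere (n : ℕ) (lam : ℝ) : Set (Heis n) :=
  {q | ‖q.1‖ ≤ 1 / lam ∧ (q.2 = pansuProfile lam ‖q.1‖ ∨ q.2 = -pansuProfile lam ‖q.1‖)}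

/-- The bounded domain enclosed by `S_λ`. -/
def pansuBall (n : ℕ) (lam : ℝ) : Set (Heis n) :=
  {q | ‖q.1‖ < 1 / lam ∧ |q.2| < pansuProfile lam ‖q.1‖}

/-- The Heisenberg translation by `(0, c)`. -/
def vertTranslate (c : ℝ) (q : Heis n) : Heis n := (q.1, q.2 + c)

end Heis

end

/-! Off the `t`-axis an invariant hypersurface is tangent to the `U(n)`-orbits, so its differential
has only a radial and a vertical component and `e2n` lies in the complex line of `z`. Moving along
an orbit rotates `e2n` infinitesimally (`fderiv_e2n_rotation`). For `a` in `ξ'`, which is orthogonal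
to `z` and `J z`, this computes `∇_a e2n`; the term `α J'` cancels its `J a` component, leaving the
scalar `k = -P/ρ`, where `P = ⟨e2n, z⟩` and `ρ = |z|²`. That is umbilicity.

With `Q = ⟨e2n, J z⟩` one has `P² + Q² = ρ`. The equation `l = 2k` prescribes the derivative of
`e2n` along `en`, and makes `P²/ρ²` and then `t + (arctan(Q/P) + QP/ρ)/(2λ²)` first integrals
(`fderiv_kappaSq`, `fderiv_centre`). Their values are `λ²` and the height `c` of the centre of a
Pansu sphere through the point (`mem_pansuSphere`). At a point of maximal `|z|` the normal is
radial, which gives `λ = 1/max |z|`. Points on the axis are isolated, and removing them does not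
disconnect a manifold of dimension `2n ≥ 2`; hence `λ` and `c` are the same everywhere
(`mem_of_clopen_off_discrete`) and the image lies in one sphere.

The map into that sphere is open by a transversality argument, so compactness makes it a covering.
Over the sphere minus a pole, which is a ball, the covering has a section. The clopen argument shows
that this section reaches every point above the ball, so the covering is injective there; the two
choices of pole give injectivity everywhere. The sign of `k` for the inward normal follows from the
strict decrease of the profile, and the reflection `t ↦ -t` fixes `c = 0`.

Only the image is assumed invariant, and several sheets could meet at a point, so tangency to the
orbits is not immediate. If a sheet were transversal to an orbit, the rotated sheet would fill an
open set of the image, whereas the image is meagre (`isMeagre_range`, `fderiv_orbit_of_ne_zero`). -/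

noncomputable section

/-! ## Zero sets of functions with nonvanishing differential -/

section ZeroSet

variable {E : Type*} [NormedAddCommGroup E] [NormedSpace ℝ E]

/-- A straightening of a function near a regular zero. -/
theorem exists_straightening [CompleteSpace E] {u : E → ℝ} {q : E} (hu : ContDiffAt ℝ 1 u q)
    (h0 : u q = 0) (hd : fderiv ℝ u q ≠ 0) :
    ∃ (ε : ℝ) (ψ : E → E), 0 < ε ∧ ψ 0 = q ∧ HasFDerivAt ψ (ContinuousLinearMap.id ℝ E) 0 ∧
      (∀ y ∈ Metric.ball (0 : E) ε, DifferentiableAt ℝ ψ y) ∧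
      Set.InjOn ψ (Metric.ball 0 ε) ∧
      (∀ y ∈ Metric.ball (0 : E) ε, u (ψ y) = fderiv ℝ u q y) ∧
      ∀ δ, 0 < δ → δ ≤ ε → ψ '' Metric.ball 0 δ ∈ 𝓝 q := by
  obtain ⟨ν, hν⟩ : ∃ ν, fderiv ℝ u q ν = 1 := by
    obtain ⟨v, hv⟩ : ∃ v, fderiv ℝ u q v ≠ 0 := by
      by_contra! h
      exact hd (ContinuousLinearMap.ext h)
    exact ⟨(fderiv ℝ u q v)⁻¹ • v, by simp [hv]⟩
  set ℓ := fderiv ℝ u q with hℓ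
  let Ψ : E → E := fun x => (x - q) + (u x - ℓ (x - q)) • ν
  have hΨq : Ψ q = 0 := by simp [Ψ, h0]
  have hΨc : ContDiffAt ℝ 1 Ψ q := by fun_prop
  have hΨd : HasFDerivAt Ψ ((ContinuousLinearEquiv.refl ℝ E : E ≃L[ℝ] E) : E →L[ℝ] E) q := by
    have hid : HasFDerivAt (fun x : E => x - q) (ContinuousLinearMap.id ℝ E) q :=
      (hasFDerivAt_id q).sub_const q
    have h1 : HasFDerivAt u ℓ q := (hu.differentiableAt (by norm_num)).hasFDerivAt
    have h2 : HasFDerivAt (fun x => ℓ (x - q)) (ℓ.comp (ContinuousLinearMap.id ℝ E)) q :=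
      ℓ.hasFDerivAt.comp q hid
    refine (hid.add ((h1.sub h2).smul_const ν)).congr_fderiv ?_
    ext v
    simp
  have hΨℓ : ∀ x, ℓ (Ψ x) = u x := by
    intro x
    simp [Ψ, hν]
  let Φ := hΨc.toOpenPartialHomeomorph Ψ hΨd one_ne_zero
  have hΦ : ∀ x, Φ x = Ψ x := fun x => rfl
  have hsrc : q ∈ Φ.source := hΨc.mem_toOpenPartialHomeomorph_source hΨd one_ne_zero
  have htgt : (0 : E) ∈ Φ.target := hΨq ▸ Φ.map_source hsrc
  have hsymm0 : Φ.symm 0 = q := by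
    rw [← hΨq, ← hΦ]; exact Φ.left_inv hsrc
  have hcs : ContDiffAt ℝ 1 Φ.symm 0 := by
    refine Φ.contDiffAt_symm (f₀' := ContinuousLinearEquiv.refl ℝ E) htgt ?_ ?_
    · rw [hsymm0]; exact hΨd
    · rw [hsymm0]; exact hΨc
  have hds : HasFDerivAt Φ.symm (ContinuousLinearMap.id ℝ E) 0 := by
    have := Φ.hasFDerivAt_symm (f' := ContinuousLinearEquiv.refl ℝ E) htgt
      (by rw [hsymm0]; exact hΨd)
    simpa using this
  obtain ⟨ε, hε, hball⟩ := Metric.eventually_nhds_iff_ball.1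
    ((hcs.eventually (by simp)).and (Φ.open_target.mem_nhds htgt))
  refine ⟨ε, Φ.symm, hε, hsymm0, hds, fun y hy => (hball y hy).1.differentiableAt (by norm_num),
    Φ.symm.injOn.mono fun y hy => (hball y hy).2, fun y hy => ?_, fun δ hδ hδε => ?_⟩
  · rw [← hΨℓ, ← hΦ, Φ.right_inv (hball y hy).2]
  · rw [← hsymm0]
    exact Φ.symm.image_mem_nhds htgt (Metric.ball_mem_nhds 0 hδ)

/-- Every vector in the kernel of the differential is the velocity of a curve in the zero set. -/
theorem exists_curve_of_mem_ker [CompleteSpace E] {u : E → ℝ} {q : E} (hu : ContDiffAt ℝ 1 u q)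
    (h0 : u q = 0) (hd : fderiv ℝ u q ≠ 0) {v : E} (hv : fderiv ℝ u q v = 0) :
    ∃ γ : ℝ → E, γ 0 = q ∧ HasDerivAt γ v 0 ∧ ∀ᶠ s in 𝓝 0, u (γ s) = 0 := by
  obtain ⟨ε, ψ, hε, hψ0, hψd, -, -, hψu, -⟩ := exists_straightening hu h0 hd
  have hline : HasDerivAt (fun s : ℝ => s • v) v 0 := by
    simpa using (hasDerivAt_id (0 : ℝ)).smul_const v
  refine ⟨fun s => ψ (s • v), by simp [hψ0], ?_, ?_⟩
  · have h2 : HasFDerivAt ψ (ContinuousLinearMap.id ℝ E) ((0 : ℝ) • v) := by rwa [zero_smul]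
    simpa [Function.comp_def] using h2.comp_hasDerivAt 0 hline
  · have : ∀ᶠ s : ℝ in 𝓝 0, s • v ∈ Metric.ball (0 : E) ε := by
      refine hline.continuousAt.eventually_mem ?_
      simpa using Metric.ball_mem_nhds (0 : E) hε
    filter_upwards [this] with s hs
    rw [hψu _ hs, map_smul, hv, smul_zero]

/-- A function vanishing on the zero set has a differential vanishing on the kernel. -/
theorem fderiv_eq_zero_of_vanishing [CompleteSpace E] {u G : E → ℝ} {q : E}
    (hu : ContDiffAt ℝ 1 u q) (h0 : u q = 0) (hd : fderiv ℝ u q ≠ 0) {G' : E →L[ℝ] ℝ}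
    (hG : HasFDerivAt G G' q) (hG0 : ∀ᶠ x in 𝓝 q, u x = 0 → G x = 0) {v : E}
    (hv : fderiv ℝ u q v = 0) : G' v = 0 := by
  obtain ⟨γ, hγ0, hγd, hγu⟩ := exists_curve_of_mem_ker hu h0 hd hv
  have h1 : HasDerivAt (fun s => G (γ s)) (G' v) 0 := by
    have : HasFDerivAt G G' (γ 0) := by rwa [hγ0]
    exact this.comp_hasDerivAt 0 hγd
  have h2 : (fun s => G (γ s)) =ᶠ[𝓝 0] fun _ => 0 := by
    have : Filter.Tendsto γ (𝓝 0) (𝓝 q) := hγ0 ▸ hγd.continuousAt.tendsto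
    filter_upwards [hγu, this.eventually hG0] with s hs1 hs2 using hs2 hs1
  exact (h1.congr_of_eventuallyEq h2.symm).unique (hasDerivAt_const (0 : ℝ) (0 : ℝ))

/-- A function whose differential vanishes on the tangent spaces of the zero set is locally
constant on the zero set. -/
theorem eventually_eq_of_fderiv_eq_zero [CompleteSpace E] {u G : E → ℝ} {q : E}
    (hu : ContDiffAt ℝ 1 u q) (h0 : u q = 0) (hd : fderiv ℝ u q ≠ 0)
    (hG : ∀ᶠ x in 𝓝 q, u x = 0 → DifferentiableAt ℝ G x ∧
      ∀ v, fderiv ℝ u x v = 0 → fderiv ℝ G x v = 0) :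
    ∀ᶠ x in 𝓝 q, u x = 0 → G x = G q := by
  obtain ⟨ε, ψ, hε, hψ0, hψd, hψdiff, -, hψu, hψim⟩ := exists_straightening hu h0 hd
  have hcont : Filter.Tendsto ψ (𝓝 0) (𝓝 q) := hψ0 ▸ hψd.continuousAt.tendsto
  have hudiff : ∀ᶠ x in 𝓝 q, DifferentiableAt ℝ u x :=
    (hu.eventually (by simp)).mono fun x hx => hx.differentiableAt (by norm_num)
  obtain ⟨δ, hδ, hball⟩ := Metric.eventually_nhds_iff_ball.1
    ((hcont.eventually (hG.and hudiff)).and (Metric.ball_mem_nhds (0 : E) hε))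
  have hmin : min δ ε ≤ ε := min_le_right _ _
  filter_upwards [hψim (min δ ε) (lt_min hδ hε) hmin] with x hx hux
  obtain ⟨y, hy, rfl⟩ := hx
  have hyε : y ∈ Metric.ball (0 : E) ε := Metric.ball_subset_ball hmin hy
  have hyδ : y ∈ Metric.ball (0 : E) δ := Metric.ball_subset_ball (min_le_left _ _) hy
  -- As `y` lies in the kernel of `ℓ`, the whole segment from `0` to `y` is mapped by `ψ` into the
  -- zero set, and `G` has zero derivative along it.
  have hℓy : fderiv ℝ u q y = 0 := by rw [← hψu y hyε, hux]
  have hmem : ∀ s ∈ Set.Icc (0 : ℝ) 1, s • y ∈ Metric.ball (0 : E) δ := by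
    intro s hs
    rw [mem_ball_zero_iff, norm_smul, Real.norm_of_nonneg hs.1]
    have := mem_ball_zero_iff.1 hyδ
    nlinarith [norm_nonneg y, hs.2]
  have hderiv : ∀ s ∈ Set.Icc (0 : ℝ) 1, HasDerivAt (fun s : ℝ => G (ψ (s • y))) 0 s := by
    intro s hs
    obtain ⟨⟨hb1, hb2⟩, hb3⟩ := hball _ (hmem s hs)
    have hzero : u (ψ (s • y)) = 0 := by rw [hψu _ hb3, map_smul, hℓy, smul_zero]
    obtain ⟨hGd, hGk⟩ := hb1 hzero
    have hline : HasDerivAt (fun s : ℝ => s • y) y s := by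
      simpa using (hasDerivAt_id s).smul_const y
    have hψl : HasDerivAt (fun s : ℝ => ψ (s • y)) (fderiv ℝ ψ (s • y) y) s :=
      (hψdiff _ hb3).hasFDerivAt.comp_hasDerivAt s hline
    have h1 : HasDerivAt (fun s : ℝ => u (ψ (s • y)))
        (fderiv ℝ u (ψ (s • y)) (fderiv ℝ ψ (s • y) y)) s :=
      hb2.hasFDerivAt.comp_hasDerivAt s hψl
    have h2 : (fun s : ℝ => u (ψ (s • y))) =ᶠ[𝓝 s] fun _ => 0 := by
      filter_upwards [hline.continuousAt.eventually_mem
        (Metric.isOpen_ball.mem_nhds hb3)] with s' hs'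
      rw [hψu _ hs', map_smul, hℓy, smul_zero]
    have h3 := (h1.congr_of_eventuallyEq h2.symm).unique (hasDerivAt_const s (0 : ℝ))
    have h4 := hGd.hasFDerivAt.comp_hasDerivAt s hψl
    rwa [hGk _ h3] at h4
  have := constant_of_has_deriv_right_zero
    (f := fun s : ℝ => G (ψ (s • y))) (a := 0) (b := 1)
    (fun s hs => (hderiv s hs).continuousAt.continuousWithinAt)
    (fun s hs => (hderiv s ⟨hs.1, hs.2.le⟩).hasDerivWithinAt) 1 (by simp)
  simpa [hψ0] using this

/-- A sign change along a curve persists under perturbation. -/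
theorem eventually_exists_zero {X : Type*} [TopologicalSpace X] {F : X × ℝ → ℝ} {q : X} {d : ℝ}
    (hF : ∀ᶠ y in 𝓝 (q, (0 : ℝ)), ContinuousAt F y) (h0 : F (q, 0) = 0)
    (hd : HasDerivAt (fun s => F (q, s)) d 0) (hd0 : d ≠ 0) {ε : ℝ} (hε : 0 < ε) :
    ∀ᶠ x in 𝓝 q, ∃ s, |s| < ε ∧ F (x, s) = 0 := by
  wlog hpos : 0 < d generalizing F d
  · have := this (F := fun y => - F y) (d := -d) (hF.mono fun y hy => hy.neg) (by simp [h0])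
      hd.neg (neg_ne_zero.2 hd0) (by
        rcases lt_or_gt_of_ne hd0 with h | h
        · linarith
        · exact absurd h hpos)
    simpa using this
  rw [nhds_prod_eq] at hF
  obtain ⟨pX, hpX, pR, hpR, hpq⟩ := Filter.eventually_prod_iff.1 hF
  obtain ⟨δ, hδ, hball⟩ := Metric.eventually_nhds_iff_ball.1 hpR
  have hslope := hd.tendsto_slope.eventually (lt_mem_nhds hpos)
  have hr : ∃ s, 0 < s ∧ s < min δ ε ∧ 0 < F (q, s) := by
    have h1 : ∀ᶠ s in 𝓝[>] (0 : ℝ), 0 < slope (fun s => F (q, s)) 0 s :=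
      hslope.filter_mono (nhdsWithin_mono _ fun x hx => ne_of_gt hx)
    have h2 : ∀ᶠ s in 𝓝[>] (0 : ℝ), s ∈ Set.Ioo 0 (min δ ε) := Ioo_mem_nhdsGT (lt_min hδ hε)
    obtain ⟨s, hs1, hs2⟩ := (h1.and h2).exists
    refine ⟨s, hs2.1, hs2.2, ?_⟩
    rw [slope_def_field, h0, sub_zero, sub_zero] at hs1
    exact (div_pos_iff_of_pos_right hs2.1).1 hs1
  have hl : ∃ s, s < 0 ∧ -min δ ε < s ∧ F (q, s) < 0 := by
    have h1 : ∀ᶠ s in 𝓝[<] (0 : ℝ), 0 < slope (fun s => F (q, s)) 0 s :=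
      hslope.filter_mono (nhdsWithin_mono _ fun x hx => ne_of_lt hx)
    have h2 : ∀ᶠ s in 𝓝[<] (0 : ℝ), s ∈ Set.Ioo (-min δ ε) 0 :=
      Ioo_mem_nhdsLT (neg_lt_zero.2 (lt_min hδ hε))
    obtain ⟨s, hs1, hs2⟩ := (h1.and h2).exists
    refine ⟨s, hs2.2, hs2.1, ?_⟩
    rw [slope_def_field, h0, sub_zero, sub_zero] at hs1
    by_contra! hc
    exact absurd hs1 (not_lt.2 (div_nonpos_of_nonneg_of_nonpos hc hs2.2.le))
  obtain ⟨s₂, hs₂0, hs₂, hFs₂⟩ := hr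
  obtain ⟨s₁, hs₁0, hs₁, hFs₁⟩ := hl
  have hsub : Set.Icc s₁ s₂ ⊆ Metric.ball 0 (min δ ε) := by
    intro s hs
    rw [mem_ball_zero_iff, Real.norm_eq_abs, abs_lt]
    exact ⟨hs₁.trans_le hs.1, hs.2.trans_lt hs₂⟩
  -- The values at the two fixed times keep their opposite signs when `q` is perturbed, so the
  -- intermediate value theorem applies on `[s₁, s₂]`.
  have hcat : ∀ x, pX x → ∀ s ∈ Set.Icc s₁ s₂, ContinuousAt F (x, s) := fun x hx s hs =>
    hpq hx (hball s (Metric.ball_subset_ball (min_le_left _ _) (hsub hs)))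
  have hle : s₁ ≤ s₂ := (hs₁0.trans hs₂0).le
  have hqX : pX q := hpX.self_of_nhds
  have hc : ∀ s ∈ Set.Icc s₁ s₂, ContinuousAt (fun x => F (x, s)) q := fun s hs =>
    ContinuousAt.comp (f := fun x => (x, s)) (hcat q hqX s hs) (by fun_prop)
  filter_upwards [hpX, (hc s₁ ⟨le_rfl, hle⟩).eventually (gt_mem_nhds hFs₁),
    (hc s₂ ⟨hle, le_rfl⟩).eventually (lt_mem_nhds hFs₂)] with x hx h1 h2
  have hcx : ContinuousOn (fun s => F (x, s)) (Set.Icc s₁ s₂) := fun s hs =>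
    (ContinuousAt.comp (f := fun s => (x, s)) (hcat x hx s hs)
      (by fun_prop)).continuousWithinAt
  obtain ⟨s, hs, hs0⟩ := intermediate_value_Icc hle hcx ⟨h1.le, h2.le⟩
  refine ⟨s, ?_, hs0⟩
  have := hsub hs
  rw [mem_ball_zero_iff, Real.norm_eq_abs] at this
  exact this.trans_le (min_le_right _ _)

/-- The zero set of a function with nonvanishing differential is nowhere dense. -/
theorem isNowhereDense_zeroSet {u : E → ℝ} {W : Set E} (hW : IsOpen W) (hu : ContinuousOn u W)
    (hd : ∀ q ∈ W, fderiv ℝ u q ≠ 0) : IsNowhereDense {q ∈ W | u q = 0} := by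
  rw [IsNowhereDense, Set.eq_empty_iff_forall_notMem]
  intro x hx
  have hO : IsOpen (interior (closure {q ∈ W | u q = 0})) := isOpen_interior
  obtain ⟨y, hy, hyW, -⟩ := mem_closure_iff.1 (interior_subset hx) _ hO hx
  have hnhds : interior (closure {q ∈ W | u q = 0}) ∩ W ∈ 𝓝 y := (hO.inter hW).mem_nhds ⟨hy, hyW⟩
  have hzero : ∀ z ∈ interior (closure {q ∈ W | u q = 0}) ∩ W, u z = 0 := by
    rintro z ⟨hz, hzW⟩
    by_contra hne
    have h1 := (hu.continuousAt (hW.mem_nhds hzW)).eventually_ne hne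
    obtain ⟨w, hw, hwW, hw0⟩ := mem_closure_iff_nhds.1 (interior_subset hz) _ h1
    exact hw hw0
  refine hd y hyW ?_
  have : u =ᶠ[𝓝 y] fun _ => 0 := Filter.eventually_of_mem hnhds hzero
  rw [this.fderiv_eq]
  simp

end ZeroSet

namespace Heis

variable {n : ℕ}

/-! ## The Levi metric as a real inner product -/

theorem levi_eq_re_inner (a b : CVec n) : levi a b = (inner ℂ a b).re := by
  rw [PiLp.inner_apply, Complex.re_sum]
  refine Finset.sum_congr rfl fun j _ => ?_
  simp [Complex.mul_re]; ring

theorem levi_comm (a b : CVec n) : levi a b = levi b a := by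
  simp only [levi, mul_comm]

theorem levi_add_left (a b c : CVec n) : levi (a + b) c = levi a c + levi b c := by
  simp [levi_eq_re_inner]

theorem levi_smul_left (r : ℝ) (a c : CVec n) : levi (r • a) c = r * levi a c := by
  simp only [levi, Finset.mul_sum]
  refine Finset.sum_congr rfl fun j _ => ?_
  simp; ring

theorem levi_add_right (a b c : CVec n) : levi a (b + c) = levi a b + levi a c := by
  rw [levi_comm, levi_add_left, levi_comm b, levi_comm c]

theorem levi_smul_right (r : ℝ) (a c : CVec n) : levi a (r • c) = r * levi a c := by
  rw [levi_comm, levi_smul_left, levi_comm]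

theorem levi_neg_left (a c : CVec n) : levi (-a) c = -levi a c := by
  rw [← neg_one_smul ℝ, levi_smul_left]; ring

theorem levi_neg_right (a c : CVec n) : levi a (-c) = -levi a c := by
  rw [levi_comm, levi_neg_left, levi_comm]

theorem levi_sub_left (a b c : CVec n) : levi (a - b) c = levi a c - levi b c := by
  rw [sub_eq_add_neg, levi_add_left, levi_neg_left]; ring

theorem levi_sub_right (a b c : CVec n) : levi a (b - c) = levi a b - levi a c := by
  rw [levi_comm, levi_sub_left, levi_comm b, levi_comm c]

theorem levi_zero_left (a : CVec n) : levi 0 a = 0 := by simp [levi]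

theorem levi_zero_right (a : CVec n) : levi a 0 = 0 := by simp [levi]

theorem J_J (a : CVec n) : J (J a) = -a := by simp [J, smul_smul]

theorem levi_J_left (a b : CVec n) : levi (J a) b = -levi a (J b) := by
  simp only [levi, ← Finset.sum_neg_distrib]
  refine Finset.sum_congr rfl fun j _ => ?_
  simp [J]

theorem levi_J_J (a b : CVec n) : levi (J a) (J b) = levi a b := by
  rw [levi_J_left, J_J, levi_neg_right, neg_neg]

theorem levi_J_self' (a : CVec n) : levi (J a) a = 0 := by rw [levi_comm, levi_J_self]

theorem eq_of_levi_eq {a b : CVec n} (h : ∀ c, levi a c = levi b c) : a = b := by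
  have h1 : levi (a - b) (a - b) = 0 := by rw [levi_sub_left, h, sub_self]
  rw [levi_self] at h1
  exact sub_eq_zero.1 (norm_eq_zero.1 (pow_eq_zero_iff two_ne_zero |>.1 h1))

theorem levi_self_pos {a : CVec n} (h : a ≠ 0) : 0 < levi a a := by
  rw [levi_self]; positivity

/-- Removes coordinates: the base point enters a horizontal vector only through the pairing with `J
z`. -/
theorem hor_eq (q : Heis n) (a : CVec n) : hor q a = (a, -levi a (J q.1)) := by
  refine Prod.ext rfl ?_
  simp only [hor, levi, ← Finset.sum_neg_distrib, LinearMap.coe_mk, AddHom.coe_mk]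
  refine Finset.sum_congr rfl fun j _ => ?_
  simp [J]; ring

/-- The Levi metric as a continuous bilinear map. -/
def leviL : CVec n →L[ℝ] CVec n →L[ℝ] ℝ :=
  LinearMap.mkContinuous₂
    (LinearMap.mk₂ ℝ levi levi_add_left levi_smul_left levi_add_right
      (fun r a c => levi_smul_right r a c)) 1 fun a b => by
    simp only [LinearMap.mk₂_apply, one_mul, levi_eq_re_inner]
    exact (Complex.abs_re_le_norm _).trans (norm_inner_le_norm a b)

theorem leviL_apply (a b : CVec n) : leviL a b = levi a b := rfl

/-- The CR structure as a continuous linear map. -/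
def JL : CVec n →L[ℝ] CVec n := LinearMap.toContinuousLinearMap J

theorem JL_apply (a : CVec n) : JL a = J a := rfl

section Calculus

variable {X : Type*} [NormedAddCommGroup X] [NormedSpace ℝ X]

theorem hasFDerivAt_levi {f g : X → CVec n} {f' g' : X →L[ℝ] CVec n} {x : X}
    (hf : HasFDerivAt f f' x) (hg : HasFDerivAt g g' x) :
    HasFDerivAt (fun y => levi (f y) (g y)) (leviL.flip (g x) ∘L f' + leviL (f x) ∘L g') x := by
  refine ((leviL (n := n)).hasFDerivAt_of_bilinear hf hg).congr_fderiv ?_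
  ext v
  simp [ContinuousLinearMap.precompR, ContinuousLinearMap.precompL, add_comm]

theorem hasFDerivAt_J {f : X → CVec n} {f' : X →L[ℝ] CVec n} {x : X}
    (hf : HasFDerivAt f f' x) : HasFDerivAt (fun y => J (f y)) (JL ∘L f') x :=
  JL.hasFDerivAt.comp x hf

end Calculus

/-! ## Skew-Hermitian fields -/

/-- A skew-Hermitian endomorphism: an infinitesimal rotation. -/
structure IsSkewHermitian (V : CVec n →L[ℝ] CVec n) : Prop where
  skew : ∀ x y, levi (V x) y = -levi x (V y)
  comm : ∀ x, V (J x) = J (V x)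

theorem IsSkewHermitian.levi_self {V : CVec n →L[ℝ] CVec n} (hV : IsSkewHermitian V)
    (x : CVec n) : levi (V x) x = 0 := by
  have := hV.skew x x
  rw [levi_comm x] at this
  linarith

/-- The infinitesimal rotations are transitive on directions tangent to spheres. -/
theorem exists_isSkewHermitian {z w : CVec n} (hz : z ≠ 0) (h : levi w z = 0) :
    ∃ V : CVec n →L[ℝ] CVec n, IsSkewHermitian V ∧ V z = w := by
  have hzz : (inner ℂ z z : ℂ) ≠ 0 := inner_self_ne_zero.2 hz
  have him : (inner ℂ w z : ℂ) = ((inner ℂ w z : ℂ).im : ℂ) * Complex.I := by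
    apply Complex.ext
    · rw [← levi_eq_re_inner, h]; simp
    · simp
  have hzr : (inner ℂ z z : ℂ) = ((‖z‖ ^ 2 : ℝ) : ℂ) := by
    rw [inner_self_eq_norm_sq_to_K]; simp
  have hzn : (‖z‖ ^ 2 : ℝ) ≠ 0 := pow_ne_zero 2 (norm_ne_zero_iff.2 hz)
  set β := (inner ℂ w z : ℂ).im with hβ
  -- The rank-two map `x ↦ ⟨z,x⟩w - ⟨w,x⟩z` is skew-Hermitian and sends `z` to `|z|²w - iβz`,
  -- because `⟨w,z⟩` is purely imaginary. The term `β J x`, also skew-Hermitian, cancels the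
  -- unwanted part.
  let L : CVec n →ₗ[ℝ] CVec n :=
    { toFun := fun x => (‖z‖ ^ 2)⁻¹ • ((inner ℂ z x : ℂ) • w - (inner ℂ w x : ℂ) • z + β • J x)
      map_add' := fun x y => by
        simp only [inner_add_right, map_add, add_smul, smul_add]
        module
      map_smul' := fun r x => by
        have h1 : ∀ v : CVec n, (inner ℂ v (r • x) : ℂ) = (r : ℂ) * inner ℂ v x := fun v => by
          rw [← inner_smul_right]; rfl
        have h2 : ∀ (c : ℂ) (v : CVec n), ((r : ℂ) * c) • v = r • c • v := fun c v => by
          rw [mul_smul]; rfl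
        simp only [h1, h2, map_smul, RingHom.id_apply]
        module }
  have hL : ∀ x, L x =
      (‖z‖ ^ 2)⁻¹ • ((inner ℂ z x : ℂ) • w - (inner ℂ w x : ℂ) • z + β • J x) := fun x => rfl
  refine ⟨LinearMap.toContinuousLinearMap L, ⟨fun x y => ?_, fun x => ?_⟩, ?_⟩
  · simp only [LinearMap.coe_toContinuousLinearMap', hL, levi_smul_left, levi_smul_right,
      levi_add_left, levi_add_right, levi_sub_left, levi_sub_right, levi_J_left]
    have e1 : ∀ (c : ℂ) (v v' : CVec n), levi (c • v) v' = ((starRingEnd ℂ) c * inner ℂ v v').re :=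
      fun c v v' => by rw [levi_eq_re_inner, inner_smul_left]
    have e2 : ∀ (c : ℂ) (v v' : CVec n), levi v (c • v') = (c * inner ℂ v v').re :=
      fun c v v' => by rw [levi_eq_re_inner, inner_smul_right]
    rw [e1, e1, e2, e2, inner_conj_symm, inner_conj_symm, mul_comm (inner ℂ z y : ℂ),
      mul_comm (inner ℂ w y : ℂ)]
    ring
  · simp only [LinearMap.coe_toContinuousLinearMap', hL]
    have h1 : ∀ v : CVec n, (inner ℂ v (J x) : ℂ) = Complex.I * inner ℂ v x := fun v =>
      inner_smul_right _ _ _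
    simp only [h1, map_smul, map_add, map_sub]
    have h2 : ∀ (c : ℂ) (v : CVec n), J (c • v) = (Complex.I * c) • v := fun c v => by
      rw [mul_smul]; rfl
    simp only [h2]
  · simp only [LinearMap.coe_toContinuousLinearMap', hL]
    rw [him, hzr]
    have h1 : (((β : ℝ) : ℂ) * Complex.I) • z = β • J z := by rw [mul_smul]; rfl
    have h2 : (((‖z‖ ^ 2 : ℝ) : ℂ)) • w = (‖z‖ ^ 2 : ℝ) • w := rfl
    rw [h1, h2, sub_add_cancel, inv_smul_smul₀ hzn]

/-! ## Infinitesimally rotationally symmetric hypersurfaces -/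

/-- The zero set of `u` in `W` is a smooth hypersurface off the `t`-axis, whose tangent spaces
contain the directions tangent to the orbits of the unitary group. -/
structure IsInfSymmetric (u : Heis n → ℝ) (W : Set (Heis n)) : Prop where
  isOpen : IsOpen W
  contDiffOn : ContDiffOn ℝ ∞ u W
  fderiv_ne : ∀ q ∈ W, fderiv ℝ u q ≠ 0
  ne_zero : ∀ q ∈ W, q.1 ≠ 0
  orbit : ∀ q ∈ W, u q = 0 → ∀ w, levi w q.1 = 0 → fderiv ℝ u q (w, 0) = 0

/-- The component of the differential along the radial direction. -/
def radial (u : Heis n → ℝ) (q : Heis n) : ℝ := fderiv ℝ u q (q.1, 0) / levi q.1 q.1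

/-- The component of the differential along the vertical direction. -/
def vert (u : Heis n → ℝ) (q : Heis n) : ℝ := fderiv ℝ u q (0, 1)

namespace IsInfSymmetric

variable {u : Heis n → ℝ} {W : Set (Heis n)} {q : Heis n}

theorem contDiffAt (h : IsInfSymmetric u W) (hq : q ∈ W) : ContDiffAt ℝ ∞ u q :=
  h.contDiffOn.contDiffAt (h.isOpen.mem_nhds hq)

theorem contDiffAt_one (h : IsInfSymmetric u W) (hq : q ∈ W) : ContDiffAt ℝ 1 u q :=
  (h.contDiffAt hq).of_le (by exact_mod_cast le_top)

theorem contDiffAt_fderiv (h : IsInfSymmetric u W) (hq : q ∈ W) :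
    ContDiffAt ℝ 1 (fderiv ℝ u) q :=
  (h.contDiffAt hq).fderiv_right (m := 1) (by norm_num; exact WithTop.coe_le_coe.2 (le_top : (2 : ℕ∞) ≤ ⊤))

/-- Splitting `v` into a part orthogonal to `z`, a multiple of `z` and a vertical part, the first is
killed because it is tangent to the orbit. -/
theorem fderiv_apply (h : IsInfSymmetric u W) (hq : q ∈ W) (h0 : u q = 0) (v : Heis n) :
    fderiv ℝ u q v = radial u q * levi v.1 q.1 + vert u q * v.2 := by
  have hρ : levi q.1 q.1 ≠ 0 := (levi_self_pos (h.ne_zero q hq)).ne'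
  have hv : v = (v.1 - (levi v.1 q.1 / levi q.1 q.1) • q.1, 0)
      + (levi v.1 q.1 / levi q.1 q.1) • (q.1, (0 : ℝ)) + v.2 • ((0 : CVec n), (1 : ℝ)) := by
    ext <;> simp
  conv_lhs => rw [hv]
  rw [map_add, map_add, map_smul, map_smul, h.orbit q hq h0]
  · simp only [radial, vert, smul_eq_mul]; field_simp; ring
  · rw [levi_sub_left, levi_smul_left]; field_simp; ring

/-- The vertical component of a horizontal vector `a` is `-⟨a, J z⟩`, so the vertical part of `du`
becomes a multiple of `J z`. The horizontal gradient thus stays in the complex line of `z`. -/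
theorem hgrad_eq (h : IsInfSymmetric u W) (hq : q ∈ W) (h0 : u q = 0) :
    hgrad u q = radial u q • q.1 - vert u q • J q.1 := by
  refine eq_of_levi_eq fun c => ?_
  rw [levi_hgrad, h.fderiv_apply hq h0, hor_eq, levi_sub_left, levi_smul_left, levi_smul_left,
    levi_comm q.1 c, levi_comm c (J q.1)]
  ring

theorem sq_add_sq_pos (h : IsInfSymmetric u W) (hq : q ∈ W) (h0 : u q = 0) :
    0 < radial u q ^ 2 + vert u q ^ 2 := by
  by_contra! hc
  have h1 : radial u q = 0 := by nlinarith [sq_nonneg (radial u q), sq_nonneg (vert u q)]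
  have h2 : vert u q = 0 := by nlinarith [sq_nonneg (radial u q), sq_nonneg (vert u q)]
  refine h.fderiv_ne q hq (ContinuousLinearMap.ext fun v => ?_)
  rw [h.fderiv_apply hq h0, h1, h2]; simp

theorem hgrad_ne (h : IsInfSymmetric u W) (hq : q ∈ W) (h0 : u q = 0) : hgrad u q ≠ 0 := by
  intro hc
  have h1 : levi (hgrad u q) (hgrad u q) = 0 := by rw [hc, levi_zero_left]
  rw [h.hgrad_eq hq h0] at h1
  simp only [levi_sub_left, levi_sub_right, levi_smul_left, levi_smul_right, levi_J_self,
    levi_J_self', levi_J_J] at h1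
  have := levi_self_pos (h.ne_zero q hq)
  have := h.sq_add_sq_pos hq h0
  nlinarith

end IsInfSymmetric

theorem hasFDerivAt_hor (q : Heis n) (a : CVec n) :
    HasFDerivAt (fun x : Heis n => hor x a)
      ((0 : Heis n →L[ℝ] CVec n).prod
        (-(leviL a ∘L JL ∘L ContinuousLinearMap.fst ℝ (CVec n) ℝ))) q := by
  have h1 : HasFDerivAt (fun x : Heis n => -levi a (J x.1))
      (-(leviL a ∘L JL ∘L ContinuousLinearMap.fst ℝ (CVec n) ℝ)) q :=
    ((leviL a ∘L JL ∘L ContinuousLinearMap.fst ℝ (CVec n) ℝ).hasFDerivAt).neg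
  have h2 : HasFDerivAt (fun _ : Heis n => a) (0 : Heis n →L[ℝ] CVec n) q := hasFDerivAt_const a q
  refine (h2.prodMk h1).congr_of_eventuallyEq ?_
  exact Filter.Eventually.of_forall fun x => hor_eq x a

theorem differentiableAt_hgrad {u : Heis n → ℝ} {q : Heis n}
    (hu : DifferentiableAt ℝ (fderiv ℝ u) q) : DifferentiableAt ℝ (hgrad u) q := by
  have hc : ∀ a, DifferentiableAt ℝ (fun x => fderiv ℝ u x (hor x a)) q := fun a =>
    hu.clm_apply (hasFDerivAt_hor q a).differentiableAt
  rw [differentiableAt_piLp]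
  intro j
  have : (fun x => hgrad u x j) = fun x =>
      (Complex.ofRealCLM (fderiv ℝ u x (hor x (EuclideanSpace.single j 1))))
        + (Complex.ofRealCLM (fderiv ℝ u x (hor x (EuclideanSpace.single j Complex.I))))
          * Complex.I := by
    funext x
    apply Complex.ext <;> simp [hgrad]
  rw [this]
  exact ((Complex.ofRealCLM.differentiableAt.comp q (hc _))).add
    ((Complex.ofRealCLM.differentiableAt.comp q (hc _)).mul_const _)

/-- Product rule for `du` applied to the frame; the second term records that the horizontal frame
itself varies with the base point. -/
theorem levi_fderiv_hgrad {u : Heis n → ℝ} {q : Heis n}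
    (hu : DifferentiableAt ℝ (fderiv ℝ u) q) (v : Heis n) (a : CVec n) :
    levi (fderiv ℝ (hgrad u) q v) a =
      fderiv ℝ (fderiv ℝ u) q v (hor q a) - fderiv ℝ u q (0, levi a (J v.1)) := by
  have h1 := hasFDerivAt_levi (differentiableAt_hgrad hu).hasFDerivAt (hasFDerivAt_const a q)
  have h2 := hu.hasFDerivAt.clm_apply (hasFDerivAt_hor q a)
  have h3 : (fun y => levi (hgrad u y) a) = fun y => fderiv ℝ u y (hor y a) :=
    funext fun y => levi_hgrad u y a
  rw [h3] at h1
  have h4 := DFunLike.congr_fun (h1.unique h2) v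
  simp only [_root_.add_apply, ContinuousLinearMap.comp_apply,
    ContinuousLinearMap.flip_apply, leviL_apply, ContinuousLinearMap.prod_apply,
    _root_.neg_apply, _root_.zero_apply, levi_zero_right, add_zero,
    JL_apply, ContinuousLinearMap.coe_fst'] at h4
  rw [h4]
  have : ((0 : CVec n), -levi a (J v.1)) = -((0 : CVec n), levi a (J v.1)) := by simp
  rw [this, map_neg]
  ring

namespace IsInfSymmetric

variable {u : Heis n → ℝ} {W : Set (Heis n)} {q : Heis n}

theorem differentiableAt_fderiv (h : IsInfSymmetric u W) (hq : q ∈ W) :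
    DifferentiableAt ℝ (fderiv ℝ u) q := (h.contDiffAt_fderiv hq).differentiableAt (by norm_num)

theorem differentiableAt_e2n (h : IsInfSymmetric u W) (hq : q ∈ W) (h0 : u q = 0) :
    DifferentiableAt ℝ (e2n u) q := by
  have hd := differentiableAt_hgrad (h.differentiableAt_fderiv hq)
  have hne := h.hgrad_ne hq h0
  have hn : DifferentiableAt ℝ (fun x => ‖hgrad u x‖) q := by
    have : (fun x => ‖hgrad u x‖) = fun x => Real.sqrt (levi (hgrad u x) (hgrad u x)) := by
      funext x; rw [levi_self, Real.sqrt_sq (norm_nonneg _)]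
    rw [this]
    exact (hasFDerivAt_levi hd.hasFDerivAt hd.hasFDerivAt).differentiableAt.sqrt
      (levi_self_pos hne).ne'
  exact (hn.inv (norm_ne_zero_iff.2 hne)).smul hd

theorem norm_hgrad_pos (h : IsInfSymmetric u W) (hq : q ∈ W) (h0 : u q = 0) :
    0 < ‖hgrad u q‖ := norm_pos_iff.2 (h.hgrad_ne hq h0)

theorem levi_e2n_self (h : IsInfSymmetric u W) (hq : q ∈ W) (h0 : u q = 0) :
    levi (e2n u q) (e2n u q) = 1 := by
  have := h.norm_hgrad_pos hq h0
  rw [e2n, levi_smul_left, levi_smul_right, levi_self]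
  field_simp

theorem levi_fderiv_e2n (h : IsInfSymmetric u W) (hq : q ∈ W) (h0 : u q = 0) (v : Heis n) :
    levi (fderiv ℝ (e2n u) q v) (e2n u q) = 0 := by
  have hd := (h.differentiableAt_e2n hq h0).hasFDerivAt
  have h1 := hasFDerivAt_levi hd hd
  have h2 : (fun y => levi (e2n u y) (e2n u y)) =ᶠ[𝓝 q] fun _ => 1 := by
    have := (differentiableAt_hgrad (h.differentiableAt_fderiv hq)).continuousAt.eventually_ne
      (h.hgrad_ne hq h0)
    filter_upwards [this] with y hy
    have hy' : 0 < ‖hgrad u y‖ := norm_pos_iff.2 hy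
    rw [e2n, levi_smul_left, levi_smul_right, levi_self]
    field_simp
  have h3 := (h1.congr_of_eventuallyEq h2.symm).unique (hasFDerivAt_const (1 : ℝ) q)
  have h4 := DFunLike.congr_fun h3 v
  simp only [_root_.add_apply, ContinuousLinearMap.comp_apply,
    ContinuousLinearMap.flip_apply, leviL_apply, _root_.zero_apply] at h4
  rw [levi_comm (e2n u q)] at h4
  linarith

/-- The horizontal normal is equivariant under infinitesimal rotations. -/
theorem fderiv_e2n_rotation (h : IsInfSymmetric u W) (hq : q ∈ W) (h0 : u q = 0)
    {V : CVec n →L[ℝ] CVec n} (hV : IsSkewHermitian V) :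
    fderiv ℝ (e2n u) q (V q.1, 0) = V (e2n u q) := by
  have hdu := h.differentiableAt_fderiv hq
  -- The function `x ↦ du(V z, 0)` vanishes on the zero set, so its differential is a multiple of
  -- `du`.
  obtain ⟨μ, hμ⟩ : ∃ μ : ℝ, ∀ v : Heis n,
      fderiv ℝ (fderiv ℝ u) q v (V q.1, 0) + fderiv ℝ u q (V v.1, 0) = μ * fderiv ℝ u q v := by
    let VE : Heis n →L[ℝ] Heis n := (V ∘L ContinuousLinearMap.fst ℝ (CVec n) ℝ).prod 0
    have hG := hdu.hasFDerivAt.clm_apply (VE.hasFDerivAt (x := q))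
    have hvan : ∀ᶠ x in 𝓝 q, u x = 0 → fderiv ℝ u x (VE x) = 0 := by
      filter_upwards [h.isOpen.mem_nhds hq] with x hx hx0
      exact h.orbit x hx hx0 _ (hV.levi_self x.1)
    have hker := fun v => fderiv_eq_zero_of_vanishing (h.contDiffAt_one hq) h0 (h.fderiv_ne q hq)
      hG hvan (v := v)
    obtain ⟨ν, hν⟩ : ∃ ν, fderiv ℝ u q ν ≠ 0 := by
      by_contra! hc
      exact h.fderiv_ne q hq (ContinuousLinearMap.ext hc)
    simp only [_root_.add_apply, ContinuousLinearMap.comp_apply,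
      ContinuousLinearMap.flip_apply] at hker
    set g : Heis n → ℝ := fun v => fderiv ℝ u q (VE v) + fderiv ℝ (fderiv ℝ u) q v (VE q) with hg
    refine ⟨g ν / fderiv ℝ u q ν, fun v => ?_⟩
    have h1 := hker (v - (fderiv ℝ u q v / fderiv ℝ u q ν) • ν) (by
      rw [map_sub, map_smul, smul_eq_mul]; field_simp; ring)
    simp only [map_sub, map_smul, _root_.sub_apply, _root_.smul_apply,
      smul_eq_mul] at h1
    have h2 : fderiv ℝ (fderiv ℝ u) q v (V q.1, 0) + fderiv ℝ u q (V v.1, 0) = g v := by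
      rw [hg, add_comm]; rfl
    rw [h2]
    simp only [hg]
    field_simp
    field_simp at h1
    linarith
  have hsymm : ∀ v w, fderiv ℝ (fderiv ℝ u) q v w = fderiv ℝ (fderiv ℝ u) q w v :=
    fun v w => ((h.contDiffAt hq).isSymmSndFDerivAt (by
      simp [minSmoothness_of_isRCLikeNormedField]; exact WithTop.coe_le_coe.2 (le_top : (2 : ℕ∞) ≤ ⊤))) v w
  have hD : fderiv ℝ (hgrad u) q (V q.1, 0) = μ • hgrad u q + V (hgrad u q) := by
    refine eq_of_levi_eq fun a => ?_
    rw [levi_fderiv_hgrad hdu, hsymm, levi_add_left, levi_smul_left, hV.skew, levi_hgrad,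
      levi_hgrad, ← hμ (hor q a)]
    -- Because `V` commutes with `J` and is skew, the variation of the frame is exactly the vertical
    -- part of `hor q (V a)`.
    have h1 : hor q (V a) = (V a, 0) + ((0 : CVec n), levi a (J (V q.1))) := by
      rw [hor_eq, hV.skew, hV.comm]; simp
    have h2 : (hor q a).1 = a := rfl
    rw [h1, map_add, h2]
    ring
  have hne := h.norm_hgrad_pos hq h0
  have hdh := differentiableAt_hgrad hdu
  have hscal : ∃ c : ℝ, fderiv ℝ (e2n u) q (V q.1, 0) = c • e2n u q + V (e2n u q) := by
    have hn : DifferentiableAt ℝ (fun x => ‖hgrad u x‖⁻¹) q := by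
      have : (fun x => ‖hgrad u x‖) = fun x => Real.sqrt (levi (hgrad u x) (hgrad u x)) := by
        funext x; rw [levi_self, Real.sqrt_sq (norm_nonneg _)]
      have h3 : DifferentiableAt ℝ (fun x => ‖hgrad u x‖) q := by
        rw [this]
        exact (hasFDerivAt_levi hdh.hasFDerivAt hdh.hasFDerivAt).differentiableAt.sqrt
          (levi_self_pos (h.hgrad_ne hq h0)).ne'
      exact h3.inv hne.ne'
    have h4 := hn.hasFDerivAt.smul hdh.hasFDerivAt
    have h5 : fderiv ℝ (e2n u) q = _ := h4.fderiv
    refine ⟨fderiv ℝ (fun x => ‖hgrad u x‖⁻¹) q (V q.1, 0) * ‖hgrad u q‖ + μ, ?_⟩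
    rw [h5]
    simp only [_root_.add_apply, _root_.smul_apply,
      ContinuousLinearMap.smulRight_apply, hD, e2n, map_smul, smul_add, smul_smul]
    have h6 : ∀ d : ℝ, (d * ‖hgrad u q‖ + μ) * ‖hgrad u q‖⁻¹ = d + ‖hgrad u q‖⁻¹ * μ := by
      intro d; field_simp
    rw [h6]
    module
  obtain ⟨c, hc⟩ := hscal
  -- The derivative of a unit field is orthogonal to it, and so is `V e2n`; hence the scalar `c`
  -- vanishes.
  have h6 := h.levi_fderiv_e2n hq h0 (V q.1, 0)
  rw [hc, levi_add_left, levi_smul_left, h.levi_e2n_self hq h0, hV.levi_self] at h6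
  rw [hc, show c = 0 by linarith, zero_smul, zero_add]

end IsInfSymmetric

theorem hasFDerivAt_div_real {X : Type*} [NormedAddCommGroup X] [NormedSpace ℝ X] {f g : X → ℝ}
    {f' g' : X →L[ℝ] ℝ} {x : X} (hf : HasFDerivAt f f' x) (hg : HasFDerivAt g g' x)
    (hx : g x ≠ 0) :
    HasFDerivAt (fun y => f y / g y) ((g x)⁻¹ • f' - (f x / g x ^ 2) • g') x := by
  have h1 : HasFDerivAt (fun y => (g y)⁻¹) (-(g x ^ 2)⁻¹ • g') x :=
    (hasDerivAt_inv hx).comp_hasFDerivAt x hg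
  refine (hf.mul h1).congr_fderiv ?_
  ext v
  simp
  ring

/-- The radial component of the horizontal normal, times `|z|`. -/
def normalRad (u : Heis n → ℝ) (q : Heis n) : ℝ := levi (e2n u q) q.1

/-- The component of the horizontal normal along the Hopf direction `J z`, times `|z|`. -/
def normalHopf (u : Heis n → ℝ) (q : Heis n) : ℝ := levi (e2n u q) (J q.1)

/-- The square of the common eigenvalue of the shape operator, as a function of the normal. -/
def kappaSq (u : Heis n → ℝ) (q : Heis n) : ℝ := normalRad u q ^ 2 / levi q.1 q.1 ^ 2

/-- The height of the centre of the Pansu sphere of parameter `lam` osculating `{u = 0}`. -/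
def centre (lam : ℝ) (u : Heis n → ℝ) (q : Heis n) : ℝ :=
  q.2 + 1 / (2 * lam ^ 2) * (Real.arctan (normalHopf u q / normalRad u q)
    + normalHopf u q * normalRad u q / levi q.1 q.1)

theorem levi_en_fst (u : Heis n → ℝ) (q : Heis n) : levi (en u q) q.1 = normalHopf u q := by
  rw [en, levi_neg_left, levi_J_left, neg_neg, normalHopf]

theorem levi_en_J (u : Heis n → ℝ) (q : Heis n) : levi (en u q) (J q.1) = -normalRad u q := by
  rw [en, levi_neg_left, levi_J_J, normalRad]

namespace IsInfSymmetric

variable {u : Heis n → ℝ} {W : Set (Heis n)} {q : Heis n}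

theorem normalRad_eq (h : IsInfSymmetric u W) (hq : q ∈ W) (h0 : u q = 0) :
    normalRad u q = radial u q * levi q.1 q.1 / ‖hgrad u q‖ := by
  rw [normalRad, e2n, levi_smul_left, h.hgrad_eq hq h0, levi_sub_left, levi_smul_left,
    levi_smul_left, levi_J_self']
  ring

theorem normalHopf_eq (h : IsInfSymmetric u W) (hq : q ∈ W) (h0 : u q = 0) :
    normalHopf u q = -(vert u q * levi q.1 q.1 / ‖hgrad u q‖) := by
  rw [normalHopf, e2n, levi_smul_left, h.hgrad_eq hq h0, levi_sub_left, levi_smul_left,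
    levi_smul_left, levi_J_self, levi_J_J]
  ring

theorem e2n_eq (h : IsInfSymmetric u W) (hq : q ∈ W) (h0 : u q = 0) :
    e2n u q = (radial u q / ‖hgrad u q‖) • q.1 - (vert u q / ‖hgrad u q‖) • J q.1 := by
  rw [e2n]
  nth_rewrite 2 [h.hgrad_eq hq h0]
  module

theorem levi_fst_pos (h : IsInfSymmetric u W) (hq : q ∈ W) : 0 < levi q.1 q.1 :=
  levi_self_pos (h.ne_zero q hq)

theorem e2n_eq' (h : IsInfSymmetric u W) (hq : q ∈ W) (h0 : u q = 0) :
    e2n u q = (normalRad u q / levi q.1 q.1) • q.1 + (normalHopf u q / levi q.1 q.1) • J q.1 := by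
  have hρ := h.levi_fst_pos hq
  rw [h.e2n_eq hq h0, h.normalRad_eq hq h0, h.normalHopf_eq hq h0, sub_eq_add_neg, ← neg_smul]
  congr 2 <;> field_simp

/-- The normal is a unit vector in the complex line of `z`, with components `P` and `Q` there up to
the factor `|z|`. -/
theorem normalRad_sq_add (h : IsInfSymmetric u W) (hq : q ∈ W) (h0 : u q = 0) :
    normalRad u q ^ 2 + normalHopf u q ^ 2 = levi q.1 q.1 := by
  have hρ := h.levi_fst_pos hq
  have h1 := h.levi_e2n_self hq h0
  rw [h.e2n_eq' hq h0] at h1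
  simp only [levi_add_left, levi_add_right, levi_smul_left, levi_smul_right, levi_J_self,
    levi_J_self', levi_J_J] at h1
  field_simp at h1
  refine mul_right_cancel₀ hρ.ne' ?_
  linear_combination h1

/-- This is `du(v) = 0` expressed through the normal: the radial and vertical parts of a tangent
vector are proportional to `(Q, P)`. -/
theorem normalRad_mul (h : IsInfSymmetric u W) (hq : q ∈ W) (h0 : u q = 0) {v : Heis n}
    (hv : fderiv ℝ u q v = 0) : normalRad u q * levi v.1 q.1 = normalHopf u q * v.2 := by
  rw [h.fderiv_apply hq h0] at hv
  have hN := h.norm_hgrad_pos hq h0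
  rw [h.normalRad_eq hq h0, h.normalHopf_eq hq h0]
  field_simp
  linear_combination levi q.1 q.1 * hv

/-- Elements of `ξ'` are orthogonal to the radial and to the Hopf direction. -/
theorem levi_eq_zero_of_mem_xiPrime (h : IsInfSymmetric u W) (hq : q ∈ W) (h0 : u q = 0)
    {a : CVec n} (ha : a ∈ xiPrime u q) : levi a q.1 = 0 ∧ levi a (J q.1) = 0 := by
  have hmem : ∀ b, b ∈ horTangent u q → levi b (hgrad u q) = 0 := by
    intro b hb
    rw [levi_comm, levi_hgrad]
    exact hb
  obtain ⟨ha1, b, hb, rfl⟩ := ha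
  have e1 := hmem _ ha1
  have e2 := hmem b hb
  rw [h.hgrad_eq hq h0, levi_sub_right, levi_smul_right, levi_smul_right] at e1 e2
  rw [← levi_J_J b q.1, levi_comm b (J q.1), ← neg_neg (levi (J q.1) b), levi_comm (J q.1) b,
    ← levi_J_left] at e2
  -- The conditions on `J b` and on `b` form a linear system for the two pairings, with determinant
  -- `radial² + vert²`.
  have hpos := h.sq_add_sq_pos hq h0
  constructor
  · refine (mul_eq_zero.1 ?_).resolve_left hpos.ne'
    linear_combination radial u q * e1 + vert u q * e2
  · refine (mul_eq_zero.1 ?_).resolve_left hpos.ne'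
    linear_combination radial u q * e2 - vert u q * e1

/-- On `ξ'` the shape operator is a multiple of the identity. -/
theorem isCommonEigenvalue (h : IsInfSymmetric u W) (hq : q ∈ W) (h0 : u q = 0) :
    IsCommonEigenvalue u q (-(normalRad u q / levi q.1 q.1)) := by
  intro a ha
  obtain ⟨h1, h2⟩ := h.levi_eq_zero_of_mem_xiPrime hq h0 ha
  obtain ⟨V, hV, hVz⟩ := exists_isSkewHermitian (h.ne_zero q hq) h1
  have h3 : levi a (en u q) = 0 := by
    rw [en, h.e2n_eq' hq h0, map_add, map_smul, map_smul, J_J]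
    simp only [levi_neg_right, levi_add_right, levi_smul_right, h1, h2]
    ring
  have h4 : hor q a = (a, 0) := by rw [hor_eq, h2, neg_zero]
  have hρ := h.levi_fst_pos hq
  -- Here `∇_a e2n = V e2n` is a combination of `a` and `J a`, with `J a`-coefficient `-vert/|∇_b
  -- u|`. This equals `α`, so the term `α J' a` cancels it.
  rw [shape, nabla, h4, ← hVz, h.fderiv_e2n_rotation hq h0 hV, hVz, Jprime, h3, zero_smul,
    sub_zero, h.normalRad_eq hq h0, h.e2n_eq hq h0, map_sub, map_smul, map_smul, hV.comm, hVz,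
    alpha, vertT]
  rw [show fderiv ℝ u q (0, 1) = vert u q from rfl]
  have h5 : radial u q * levi q.1 q.1 / ‖hgrad u q‖ / levi q.1 q.1
      = radial u q / ‖hgrad u q‖ := by field_simp
  rw [h5]
  module

theorem isUmbilicAt (h : IsInfSymmetric u W) (hq : q ∈ W) (h0 : u q = 0) : IsUmbilicAt u q := by
  refine ⟨fun a ha => ?_, _, h.isCommonEigenvalue hq h0⟩
  rw [h.isCommonEigenvalue hq h0 a ha]
  exact Submodule.smul_mem _ _ ha

/-! ### First integrals -/

/-- The differentials of the two components of the normal, applied to a tangent vector. -/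
theorem exists_hasFDerivAt_normal (h : IsInfSymmetric u W) (hq : q ∈ W) (h0 : u q = 0)
    (hl : ell u q = 2 * -(normalRad u q / levi q.1 q.1)) :
    ∃ P' Q' R' : Heis n →L[ℝ] ℝ, HasFDerivAt (normalRad u) P' q ∧
      HasFDerivAt (normalHopf u) Q' q ∧ HasFDerivAt (fun x : Heis n => levi x.1 x.1) R' q ∧
      ∀ v, fderiv ℝ u q v = 0 → ∃ c : ℝ,
        P' v = c * (2 * normalRad u q * normalHopf u q / levi q.1 q.1) ∧
        Q' v = c * (1 - 2 * normalRad u q ^ 2 / levi q.1 q.1) ∧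
        R' v = c * (2 * normalHopf u q) ∧ v.2 = c * normalRad u q := by
  have hρ := h.levi_fst_pos hq
  have hsq := h.normalRad_sq_add hq h0
  have hfst : HasFDerivAt (fun x : Heis n => x.1) (ContinuousLinearMap.fst ℝ (CVec n) ℝ) q :=
    hasFDerivAt_fst
  have he := (h.differentiableAt_e2n hq h0).hasFDerivAt
  have hP := hasFDerivAt_levi he hfst
  have hQ := hasFDerivAt_levi he (hasFDerivAt_J hfst)
  have hR := hasFDerivAt_levi hfst hfst
  refine ⟨_, _, _, hP, hQ, hR, fun v hv => ?_⟩
  simp only [_root_.add_apply, ContinuousLinearMap.comp_apply, ContinuousLinearMap.flip_apply,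
    leviL_apply, JL_apply, ContinuousLinearMap.coe_fst']
  have hmul := h.normalRad_mul hq h0 hv
  set P := normalRad u q with hPdef
  set Q := normalHopf u q with hQdef
  set ρ := levi q.1 q.1 with hρdef
  set D := fderiv ℝ (e2n u) q with hD
  -- The coefficient of `v` along `en`: the radial and vertical parts of `v` are `c Q` and `c P`,
  -- and `P² + Q² = ρ` recovers `c`. What remains of `v` is tangent to the orbit.
  set c := (Q * levi v.1 q.1 + P * v.2) / ρ with hc
  have hcQ : c * Q = levi v.1 q.1 := by
    rw [hc, div_mul_eq_mul_div, div_eq_iff hρ.ne']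
    linear_combination -P * hmul + levi v.1 q.1 * hsq
  have hcP : c * P = v.2 := by
    rw [hc, div_mul_eq_mul_div, div_eq_iff hρ.ne']
    linear_combination Q * hmul + v.2 * hsq
  set w := v.1 - c • en u q with hw
  have hwz : levi w q.1 = 0 := by
    rw [hw, levi_sub_left, levi_smul_left, levi_en_fst, ← hQdef, hcQ, sub_self]
  obtain ⟨V, hV, hVz⟩ := exists_isSkewHermitian (h.ne_zero q hq) hwz
  have hvdec : v = (V q.1, 0) + c • hor q (en u q) := by
    rw [hVz, hor_eq, levi_en_J, neg_neg, ← hPdef]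
    refine Prod.ext ?_ ?_
    · simp [hw]
    · simp [hcP]
  have hz : q.1 = P • e2n u q + Q • en u q := by
    rw [en, h.e2n_eq' hq h0, map_add, map_smul, map_smul, J_J, ← hPdef, ← hQdef, ← hρdef]
    have : ((P ^ 2 + Q ^ 2) / ρ) • q.1 = q.1 := by rw [hsq, div_self hρ.ne', one_smul]
    nth_rewrite 1 [← this]
    module
  -- The hypothesis `l = 2k` supplies the `en` component of the derivative along `en`, and unit
  -- length its `e2n` component; together they give its pairings with `z` and `J z`.
  have hell : levi (D (hor q (en u q))) (en u q) = 2 * (P / ρ) := by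
    have : ell u q = -levi (D (hor q (en u q))) (en u q) := by
      rw [ell, nabla, levi_neg_left]
    linarith
  have hDe := h.levi_fderiv_e2n hq h0 (hor q (en u q))
  rw [← hD] at hDe
  have hJen : J (en u q) = e2n u q := by rw [en, map_neg, J_J, neg_neg]
  have hee := h.levi_e2n_self hq h0
  have hDz : levi (D (hor q (en u q))) q.1 = 2 * P * Q / ρ := by
    conv_lhs => rw [hz]
    rw [levi_add_right, levi_smul_right, levi_smul_right, hDe, hell]
    ring
  have hDJz : levi (D (hor q (en u q))) (J q.1) = -(2 * P ^ 2 / ρ) := by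
    conv_lhs => rw [hz]
    rw [map_add, map_smul, map_smul, hJen, levi_add_right, levi_smul_right, levi_smul_right, hDe,
      show J (e2n u q) = -en u q by rw [en, neg_neg], levi_neg_right, hell]
    ring
  have hDv : D v = V (e2n u q) + c • D (hor q (en u q)) := by
    rw [hvdec, map_add, map_smul, hD, h.fderiv_e2n_rotation hq h0 hV, ← hD]
  have hv1 : v.1 = V q.1 + c • en u q := by rw [hVz, hw]; simp
  -- By skewness the rotational part of `v` contributes nothing to `P'` and `Q'`.
  have hVP : levi (V (e2n u q)) q.1 = -levi (e2n u q) (V q.1) := hV.skew _ _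
  have hVQ : levi (V (e2n u q)) (J q.1) = -levi (e2n u q) (J (V q.1)) := by
    rw [hV.skew, hV.comm]
  have hen : levi (e2n u q) (en u q) = 0 := by
    rw [en, levi_neg_right, levi_J_self, neg_zero]
  refine ⟨c, ?_, ?_, ?_, hcP.symm⟩
  · rw [hDv, hv1, levi_add_left, levi_smul_left, hDz, hVP, levi_add_right, levi_smul_right, hen]
    ring
  · rw [hDv, hv1, levi_add_left, levi_smul_left, hDJz, hVQ, map_add, map_smul, hJen,
      levi_add_right, levi_smul_right, hee]
    ring
  · rw [levi_comm q.1 v.1, ← hcQ]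
    ring

/-- With `P' = 2PQ/ρ` and `ρ' = 2Q` along `en`, the two terms `4P²Q/ρ³` in `(P²/ρ²)'` cancel. The
factor `2` in `l = 2k` is exactly what this needs. -/
theorem fderiv_kappaSq (h : IsInfSymmetric u W) (hq : q ∈ W) (h0 : u q = 0)
    (hl : ell u q = 2 * -(normalRad u q / levi q.1 q.1)) :
    DifferentiableAt ℝ (kappaSq u) q ∧
      ∀ v, fderiv ℝ u q v = 0 → fderiv ℝ (kappaSq u) q v = 0 := by
  have hρ := h.levi_fst_pos hq
  obtain ⟨P', Q', R', hP, -, hR, hv⟩ := h.exists_hasFDerivAt_normal hq h0 hl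
  have hk : HasFDerivAt (kappaSq u) _ q :=
    hasFDerivAt_div_real (hP.pow 2) (hR.pow 2) (pow_ne_zero 2 hρ.ne')
  refine ⟨hk.differentiableAt, fun v hv0 => ?_⟩
  obtain ⟨c, h1, -, h3, -⟩ := hv v hv0
  rw [hk.fderiv]
  simp only [_root_.smul_apply, _root_.sub_apply, h1, h3, smul_eq_mul, nsmul_eq_mul]
  simp
  field_simp
  ring

/-- Along `en`, `arctan(Q/P)` varies at rate `-P/ρ` and `QP/ρ` at rate `P/ρ - 2P³/ρ²`. Since `λ² =
P²/ρ²`, their sum divided by `2λ²` is `-P`, which cancels `t' = P`. The condition `λ ≠ 0` keeps `P`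
away from zero. -/
theorem fderiv_centre (h : IsInfSymmetric u W) (hq : q ∈ W) (h0 : u q = 0)
    (hl : ell u q = 2 * -(normalRad u q / levi q.1 q.1)) {lam : ℝ} (hlam : lam ≠ 0)
    (hk : kappaSq u q = lam ^ 2) :
    DifferentiableAt ℝ (centre lam u) q ∧
      ∀ v, fderiv ℝ u q v = 0 → fderiv ℝ (centre lam u) q v = 0 := by
  have hρ := h.levi_fst_pos hq
  have hsq := h.normalRad_sq_add hq h0
  have hP0 : normalRad u q ≠ 0 := by
    intro hc
    rw [kappaSq, hc] at hk
    simp at hk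
    exact hlam (by simpa using hk.symm)
  obtain ⟨P', Q', R', hP, hQ, hR, hv⟩ := h.exists_hasFDerivAt_normal hq h0 hl
  have hsnd : HasFDerivAt (fun x : Heis n => x.2) (ContinuousLinearMap.snd ℝ (CVec n) ℝ) q :=
    hasFDerivAt_snd
  have hF : HasFDerivAt (centre lam u) _ q :=
    hsnd.add (((hasFDerivAt_div_real hQ hP hP0).arctan.add
      (hasFDerivAt_div_real (hQ.mul hP) hR hρ.ne')).const_mul
      (1 / (2 * lam ^ 2)))
  refine ⟨hF.differentiableAt, fun v hv0 => ?_⟩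
  obtain ⟨c, h1, h2, h3, h4⟩ := hv v hv0
  rw [hF.fderiv]
  simp only [_root_.smul_apply, _root_.sub_apply, _root_.add_apply, h1, h2, h3, smul_eq_mul,
    ContinuousLinearMap.coe_snd', h4]
  rw [← hk, kappaSq]
  set P := normalRad u q
  set Q := normalHopf u q
  set ρ := levi q.1 q.1
  have h5 : 1 + (Q / P) ^ 2 = ρ / P ^ 2 := by
    field_simp; linarith
  rw [h5]
  have h6 : Q ^ 2 = ρ - P ^ 2 := by linarith
  have h7 : (normalHopf u * normalRad u) q = Q * P := rfl
  rw [h7]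
  field_simp
  linear_combination (-2 * c) * h6

end IsInfSymmetric

end Heis

namespace Heis

variable {n : ℕ} {M : Type*} [TopologicalSpace M]

/-! ## Defining functions -/

namespace IsDefiningAt

variable {m m' : WithTop ℕ∞} {φ : M → Heis n} {p : M} {u u' : Heis n → ℝ}

theorem contDiffAt (h : IsDefiningAt m φ p u) : ContDiffAt ℝ m u (φ p) := by
  obtain ⟨V, W, -, hp, hWo, hu, -, -, him⟩ := h
  have : φ p ∈ {q ∈ W | u q = 0} := him ▸ Set.mem_image_of_mem φ hp
  exact hu.contDiffAt (hWo.mem_nhds this.1)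

theorem apply_eq_zero (h : IsDefiningAt m φ p u) : u (φ p) = 0 := by
  obtain ⟨V, W, -, hp, -, -, -, -, him⟩ := h
  have : φ p ∈ {q ∈ W | u q = 0} := him ▸ Set.mem_image_of_mem φ hp
  exact this.2

theorem fderiv_ne (h : IsDefiningAt m φ p u) : fderiv ℝ u (φ p) ≠ 0 := by
  obtain ⟨V, W, -, hp, -, -, hd, -, him⟩ := h
  have : φ p ∈ {q ∈ W | u q = 0} := him ▸ Set.mem_image_of_mem φ hp
  exact hd _ this.1

theorem of_le (h : IsDefiningAt m φ p u) (hm : m' ≤ m) : IsDefiningAt m' φ p u := by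
  obtain ⟨V, W, hV, hp, hWo, hu, hd, he, him⟩ := h
  exact ⟨V, W, hV, hp, hWo, hu.of_le hm, hd, he, him⟩

theorem eventually (h : IsDefiningAt m φ p u) : ∀ᶠ x in 𝓝 p, IsDefiningAt m φ x u := by
  obtain ⟨V, W, hV, hp, hWo, hu, hd, he, him⟩ := h
  filter_upwards [hV.mem_nhds hp] with x hx
  exact ⟨V, W, hV, hx, hWo, hu, hd, he, him⟩

theorem continuousAt (h : IsDefiningAt m φ p u) : ContinuousAt φ p := by
  obtain ⟨V, W, hV, hp, -, -, -, he, -⟩ := h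
  exact (continuousOn_iff_continuous_domRestrict.2 he.continuous).continuousAt (hV.mem_nhds hp)

theorem exists_injOn (h : IsDefiningAt m φ p u) : ∃ V ∈ 𝓝 p, Set.InjOn φ V := by
  obtain ⟨V, W, hV, hp, -, -, -, he, -⟩ := h
  exact ⟨V, hV.mem_nhds hp, Set.injOn_iff_injective.2 he.injective⟩

/-- The embedding condition, rather than mere injectivity, makes zeros close to `φ p` come from
parameters close to `p`. -/
theorem eventually_exists_mem (h : IsDefiningAt m φ p u) {N : Set M} (hN : N ∈ 𝓝 p) :
    ∀ᶠ q in 𝓝 (φ p), u q = 0 → ∃ x ∈ N, φ x = q := by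
  obtain ⟨V, W, hV, hp, hWo, hu, hd, he, him⟩ := h
  have hpW : φ p ∈ {q ∈ W | u q = 0} := him ▸ Set.mem_image_of_mem φ hp
  have h1 : (fun x : V => (x : M)) ⁻¹' N ∈ 𝓝 (⟨p, hp⟩ : V) :=
    continuous_subtype_val.continuousAt.preimage_mem_nhds hN
  rw [he.nhds_eq_comap] at h1
  obtain ⟨O, hO, hON⟩ := h1
  filter_upwards [hO, hWo.mem_nhds hpW.1] with q hqO hqW hq0
  have : q ∈ φ '' V := him ▸ ⟨hqW, hq0⟩
  obtain ⟨x, hx, rfl⟩ := this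
  exact ⟨x, hON (show (⟨x, hx⟩ : V) ∈ _ from hqO), rfl⟩

/-- Zeros of `u` near the point are values of `φ` for which `u` is still a defining function. -/
theorem eventually_exists_defining (h : IsDefiningAt m φ p u) :
    ∀ᶠ q in 𝓝 (φ p), u q = 0 → ∃ x, IsDefiningAt m φ x u ∧ φ x = q :=
  h.eventually_exists_mem h.eventually

theorem fderiv_eq_zero (h : IsDefiningAt m φ p u) (h' : IsDefiningAt m' φ p u') (hm : 1 ≤ m)
    (hm' : 1 ≤ m') {v : Heis n} (hv : fderiv ℝ u (φ p) v = 0) : fderiv ℝ u' (φ p) v = 0 := by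
  refine fderiv_eq_zero_of_vanishing (h.contDiffAt.of_le hm) h.apply_eq_zero h.fderiv_ne
    ((h'.contDiffAt.of_le hm').differentiableAt (by norm_num)).hasFDerivAt ?_ hv
  filter_upwards [h.eventually_exists_mem h'.eventually] with q hq hq0
  obtain ⟨x, hx, rfl⟩ := hq hq0
  exact hx.apply_eq_zero

end IsDefiningAt

theorem IsImmersedHypersurface.continuous {φ : M → Heis n} (hφ : IsImmersedHypersurface φ) :
    Continuous φ :=
  continuous_iff_continuousAt.2 fun p => (hφ.exists_defining p).choose_spec.continuousAt

/-- Second countability leaves countably many local sheets, each the zero set of a function without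
critical points and hence nowhere dense. -/
theorem IsImmersedHypersurface.isMeagre_range [SecondCountableTopology M] {φ : M → Heis n}
    (hφ : IsImmersedHypersurface φ) : IsMeagre (Set.range φ) := by
  choose u V W hV hp hWo hu hd he him using hφ.exists_defining
  obtain ⟨s, hs, hsU⟩ := TopologicalSpace.countable_cover_nhds fun p => (hV p).mem_nhds (hp p)
  have : Set.range φ = ⋃ p ∈ s, φ '' V p := by
    rw [← Set.image_iUnion₂, hsU, Set.image_univ]
  rw [this]
  have hcs : Countable s := hs.to_subtype
  rw [Set.biUnion_eq_iUnion]
  refine isMeagre_iUnion fun p => ?_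
  rw [him]
  exact (isNowhereDense_zeroSet (hWo p) (hu p).continuousOn (hd p)).isMeagre

/-! ## Rotational symmetry -/

/-- The isometry from the line `ℂ z` to `ℂ w` extends to a unitary map of the whole space. -/
theorem exists_linearIsometryEquiv_apply_eq {z w : CVec n} (h : ‖z‖ = ‖w‖) :
    ∃ U : CVec n ≃ₗᵢ[ℂ] CVec n, U z = w := by
  by_cases hz : z = 0
  · subst hz
    refine ⟨LinearIsometryEquiv.refl ℂ _, ?_⟩
    rw [norm_zero] at h
    simp [norm_eq_zero.1 h.symm]
  · let e := (LinearEquiv.toSpanNonzeroSingleton ℂ (CVec n) z hz)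
    let L : Submodule.span ℂ {z} →ₗᵢ[ℂ] CVec n :=
      { toLinearMap := (LinearMap.toSpanSingleton ℂ (CVec n) w) ∘ₗ e.symm.toLinearMap
        norm_map' := fun x => by
          obtain ⟨c, rfl⟩ := e.surjective x
          have : ((e c : Submodule.span ℂ {z}) : CVec n) = c • z := rfl
          simp only [LinearMap.comp_apply, LinearEquiv.coe_coe, LinearEquiv.symm_apply_apply,
            LinearMap.toSpanSingleton_apply, Submodule.coe_norm, this, norm_smul, h] }
    refine ⟨L.extend.toLinearIsometryEquiv rfl, ?_⟩
    have hzm : z ∈ Submodule.span ℂ {z} := Submodule.mem_span_singleton_self z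
    have h1 : L.extend z = L ⟨z, hzm⟩ := L.extend_apply ⟨z, hzm⟩
    have h2 : e 1 = ⟨z, hzm⟩ := Subtype.ext (one_smul ℂ z)
    have h3 : L ⟨z, hzm⟩ = w := by
      rw [← h2]
      change (e.symm (e 1)) • w = w
      rw [e.symm_apply_apply, one_smul]
    rw [LinearIsometry.coe_toLinearIsometryEquiv, h1, h3]

omit [TopologicalSpace M] in
theorem IsRotationallySymmetric.mem_range {φ : M → Heis n} (hrot : IsRotationallySymmetric φ)
    {z w : CVec n} {t : ℝ} (h : (z, t) ∈ Set.range φ) (hzw : ‖z‖ = ‖w‖) :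
    (w, t) ∈ Set.range φ := by
  obtain ⟨U, hU⟩ := exists_linearIsometryEquiv_apply_eq hzw
  have := hrot U _ h
  rwa [hU] at this

theorem norm_eq_of_levi_eq {a b : CVec n} (h : levi a a = levi b b) : ‖a‖ = ‖b‖ := by
  rw [levi_self, levi_self] at h
  exact (sq_eq_sq₀ (norm_nonneg _) (norm_nonneg _)).1 h

section Symmetric

variable [SecondCountableTopology M] {φ : M → Heis n} (hφ : IsImmersedHypersurface φ)
  (hrot : IsRotationallySymmetric φ) {m : WithTop ℕ∞} {p : M} {u : Heis n → ℝ}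

include hφ hrot

/-- The tangent spaces off the axis contain the directions tangent to the orbits. -/
theorem IsDefiningAt.fderiv_orbit_of_ne_zero (hu : IsDefiningAt m φ p u) (hm : 1 ≤ m)
    (hz : (φ p).1 ≠ 0) {w : CVec n} (hw : levi w (φ p).1 = 0) : fderiv ℝ u (φ p) (w, 0) = 0 := by
  by_contra hne
  set q := φ p with hq
  have hw0 : w ≠ 0 := by
    rintro rfl
    exact hne (by rw [show ((0 : CVec n), (0 : ℝ)) = 0 from rfl, map_zero])
  have hzn : ‖q.1‖ ≠ 0 := norm_ne_zero_iff.2 hz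
  have hwn : ‖w‖ ≠ 0 := norm_ne_zero_iff.2 hw0
  set r := ‖q.1‖ / ‖w‖ with hr
  have hr0 : r ≠ 0 := div_ne_zero hzn hwn
  let c : ℝ → CVec n := fun s => Real.cos s • q.1 + Real.sin s • r • w
  have hcn : ∀ s, ‖c s‖ = ‖q.1‖ := fun s => norm_eq_of_levi_eq (by
    simp only [c, levi_add_left, levi_add_right, levi_smul_left, levi_smul_right, hw,
      levi_comm q.1 w]
    have h1 : r * (r * levi w w) = levi q.1 q.1 := by
      rw [levi_self, levi_self, hr]; field_simp
    linear_combination Real.sin s ^ 2 * h1 + levi q.1 q.1 * Real.sin_sq_add_cos_sq s)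
  have hcc : Continuous c := by fun_prop
  have hc0 : c 0 = q.1 := by simp [c]
  have hcd : HasDerivAt c (r • w) 0 := by
    have := ((Real.hasDerivAt_cos 0).smul_const q.1).add
      ((Real.hasDerivAt_sin 0).smul_const (r • w))
    exact this.congr_deriv (by simp)
  -- `G (x, s)` has the radius and height of `x`, so it lies on the orbit of `x`, but its direction
  -- is that of `c s`, near `q.1`. Since `u` changes sign in `s`, every `x` near `q` has an orbit
  -- point on the sheet, and symmetry puts `x` itself in the image.
  let G : Heis n × ℝ → Heis n := fun y => ((‖y.1.1‖ / ‖q.1‖) • c y.2, y.1.2)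
  have hGc : Continuous G := by fun_prop
  have hG0 : G (q, 0) = q := by simp [G, hc0, hzn]
  have hGt : Filter.Tendsto G (𝓝 (q, 0)) (𝓝 q) := by
    have := hGc.tendsto (q, 0)
    rwa [hG0] at this
  have hudiff : ContDiffAt ℝ 1 u q := hu.contDiffAt.of_le hm
  have hcont : ∀ᶠ y in 𝓝 (q, (0 : ℝ)), ContinuousAt (fun y => u (G y)) y := by
    have h1 : ∀ᶠ x in 𝓝 q, ContinuousAt u x :=
      (hudiff.eventually (by simp)).mono fun x hx => hx.continuousAt
    filter_upwards [hGt.eventually h1] with y hy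
    exact ContinuousAt.comp (f := G) hy hGc.continuousAt
  have hder : HasDerivAt (fun s => u (G (q, s))) (r * fderiv ℝ u q (w, 0)) 0 := by
    have h1 : HasDerivAt (fun s => G (q, s)) (r • w, 0) 0 := by
      have h2 : (fun s => G (q, s)) = fun s => (c s, q.2) := by
        funext s; simp [G, hzn]
      rw [h2]
      exact hcd.prodMk (hasDerivAt_const 0 q.2)
    have h3 : HasFDerivAt u (fderiv ℝ u q) (G (q, 0)) := by
      rw [hG0]; exact (hudiff.differentiableAt (by norm_num)).hasFDerivAt
    have h4 := h3.comp_hasDerivAt 0 h1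
    rw [show ((r • w, (0 : ℝ)) : Heis n) = r • (w, (0 : ℝ)) by simp, map_smul, smul_eq_mul] at h4
    exact h4
  have hrange : ∀ᶠ y in 𝓝 (q, (0 : ℝ)), u (G y) = 0 → G y ∈ Set.range φ :=
    (hGt.eventually hu.eventually_exists_defining).mono fun y hy h0 => by
      obtain ⟨x, -, hx⟩ := hy h0
      exact ⟨x, hx⟩
  rw [nhds_prod_eq] at hrange
  obtain ⟨pX, hpX, pR, hpR, hpq⟩ := Filter.eventually_prod_iff.1 hrange
  obtain ⟨ε, hε, hball⟩ := Metric.eventually_nhds_iff_ball.1 hpR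
  have hnear := eventually_exists_zero (F := fun y : Heis n × ℝ => u (G y)) hcont
    (by simp only [hG0]; exact hu.apply_eq_zero) hder (mul_ne_zero hr0 hne) hε
  have hmem : Set.range φ ∈ 𝓝 q := by
    filter_upwards [hnear, hpX] with x hx hxX
    obtain ⟨s, hs, hs0⟩ := hx
    have h1 : G (x, s) ∈ Set.range φ :=
      hpq hxX (hball s (by simpa [Real.norm_eq_abs] using hs)) hs0
    refine hrot.mem_range (w := x.1) h1 ?_
    rw [norm_smul, hcn, Real.norm_of_nonneg (by positivity)]
    field_simp
  refine not_isMeagre_of_isOpen isOpen_interior ⟨q, mem_interior_iff_mem_nhds.2 hmem⟩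
    (hφ.isMeagre_range.mono interior_subset)

/-- The tangent spaces on the axis are horizontal. -/
theorem IsDefiningAt.fderiv_of_eq_zero (hn : 1 ≤ n) (hu : IsDefiningAt m φ p u) (hm : 1 ≤ m)
    (hz : (φ p).1 = 0) (a : CVec n) : fderiv ℝ u (φ p) (a, 0) = 0 := by
  set q := φ p with hq
  -- A single complex direction has real dimension two, so the differential has a nonzero kernel
  -- vector in it.
  obtain ⟨w, hw0, hw⟩ : ∃ w : CVec n, w ≠ 0 ∧ fderiv ℝ u q (w, 0) = 0 := by
    let f : CVec n →ₗ[ℝ] ℝ := (fderiv ℝ u q).toLinearMap ∘ₗ LinearMap.inl ℝ (CVec n) ℝ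
    let b : CVec n := EuclideanSpace.single ⟨0, hn⟩ 1
    have hb : levi b b = 1 := by rw [levi_self]; simp [b]
    by_cases hfb : f b = 0
    · refine ⟨b, ?_, hfb⟩
      rintro hb0
      rw [hb0, levi_zero_left] at hb
      exact zero_ne_one hb
    · refine ⟨f (J b) • b - f b • J b, fun h0 => ?_, ?_⟩
      · have h1 : levi (f (J b) • b - f b • J b) (J b) = -f b := by
          rw [levi_sub_left, levi_smul_left, levi_smul_left, levi_J_self, levi_J_J, hb]; ring
        rw [h0, levi_zero_left] at h1
        exact hfb (by linarith)
      · change f (f (J b) • b - f b • J b) = 0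
        rw [map_sub, map_smul, map_smul, smul_eq_mul, smul_eq_mul]
        ring
  have hudiff : ContDiffAt ℝ 1 u q := hu.contDiffAt.of_le hm
  obtain ⟨γ, hγ0, hγd, hγu⟩ := exists_curve_of_mem_ker hudiff hu.apply_eq_zero hu.fderiv_ne hw
  have hγt : Filter.Tendsto γ (𝓝 0) (𝓝 q) := hγ0 ▸ hγd.continuousAt.tendsto
  -- Along a curve leaving the axis with velocity `w`, this vector is orthogonal to the position
  -- `z`, hence killed. Dividing by `s²` and letting `s → 0` replaces `z` by `w`, and `w` is in the
  -- kernel as well.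
  have hperp : ∀ᶠ s in 𝓝 (0 : ℝ),
      fderiv ℝ u (γ s) (levi (γ s).1 (γ s).1 • a - levi a (γ s).1 • (γ s).1, 0) = 0 := by
    filter_upwards [hγu, hγt.eventually hu.eventually_exists_defining] with s hs hs'
    obtain ⟨x, hx, hxs⟩ := hs' hs
    by_cases h0 : (γ s).1 = 0
    · rw [h0, levi_zero_left, levi_zero_right, zero_smul, zero_smul, sub_zero,
        show ((0 : CVec n), (0 : ℝ)) = 0 from rfl, map_zero]
    · rw [← hxs]
      refine hx.fderiv_orbit_of_ne_zero hφ hrot hm (by rwa [hxs]) ?_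
      rw [hxs, levi_sub_left, levi_smul_left, levi_smul_left]
      ring
  let y : ℝ → CVec n := fun s => s⁻¹ • (γ s).1
  have hy : Filter.Tendsto y (𝓝[≠] 0) (𝓝 w) := by
    have h1 : HasDerivAt (fun s => (γ s).1) w 0 :=
      (ContinuousLinearMap.fst ℝ (CVec n) ℝ).hasFDerivAt.comp_hasDerivAt 0 hγd
    refine (hasDerivAt_iff_tendsto_slope.1 h1).congr fun s => ?_
    rw [slope_def_module, hγ0, hz]
    simp [y]
  have hlim : Filter.Tendsto
      (fun s => fderiv ℝ u (γ s) (levi (y s) (y s) • a - levi a (y s) • y s, 0)) (𝓝[≠] 0)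
      (𝓝 (fderiv ℝ u q (levi w w • a - levi a w • w, 0))) := by
    have h1 : Filter.Tendsto (fun s => fderiv ℝ u (γ s)) (𝓝[≠] 0) (𝓝 (fderiv ℝ u q)) :=
      ((hudiff.fderiv_right (m := 0) (by simp)).continuousAt.tendsto.comp hγt).mono_left
        nhdsWithin_le_nhds
    have hlevi : Continuous fun x : CVec n => ((levi x x • a - levi a x • x, 0) : Heis n) := by
      have c1 : Continuous fun x : CVec n => levi x x := by
        simp only [levi_self]; fun_prop
      have c2 : Continuous fun x : CVec n => levi a x := (leviL a).continuous
      fun_prop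
    exact (isBoundedBilinearMap_apply.continuous.tendsto _).comp
      (h1.prodMk_nhds ((hlevi.tendsto w).comp hy))
  have hzero : ∀ᶠ s in 𝓝[≠] (0 : ℝ),
      fderiv ℝ u (γ s) (levi (y s) (y s) • a - levi a (y s) • y s, 0) = 0 := by
    filter_upwards [hperp.filter_mono nhdsWithin_le_nhds] with s hs
    have h1 : ((levi (y s) (y s) • a - levi a (y s) • y s, 0) : Heis n) =
        (s⁻¹ * s⁻¹) • (levi (γ s).1 (γ s).1 • a - levi a (γ s).1 • (γ s).1, (0 : ℝ)) := by
      refine Prod.ext ?_ (by simp)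
      simp only [y, levi_smul_left, levi_smul_right, Prod.smul_mk]
      module
    rw [h1, map_smul, hs, smul_zero]
  have h2 := tendsto_nhds_unique (hlim.congr' hzero) tendsto_const_nhds
  have h3 : ((levi w w • a - levi a w • w, 0) : Heis n) =
      levi w w • (a, (0 : ℝ)) - levi a w • (w, (0 : ℝ)) := by simp
  rw [h3, map_sub, map_smul, map_smul, hw, smul_zero, sub_zero] at h2
  exact (mul_eq_zero.1 h2).resolve_left (levi_self_pos hw0).ne'

/-- On the axis the tangent space is horizontal and equals the contact plane. Off the axis it
contains `(J z, 0)`, on which the contact form is `|z|² ≠ 0`. -/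
theorem isRegular_iff (hn : 1 ≤ n) : IsRegular φ p ↔ (φ p).1 ≠ 0 := by
  constructor
  · rintro ⟨u, hu, hne⟩ hz
    refine hne ?_
    have h1 := hu.fderiv_of_eq_zero hφ hrot hn (by norm_num) hz
    have h2 : ∀ v : Heis n, fderiv ℝ u (φ p) v = v.2 * fderiv ℝ u (φ p) (0, 1) := by
      intro v
      have : v = (v.1, 0) + v.2 • ((0 : CVec n), (1 : ℝ)) := by ext <;> simp
      conv_lhs => rw [this]
      rw [map_add, map_smul, h1, zero_add, smul_eq_mul]
    have h3 : fderiv ℝ u (φ p) (0, 1) ≠ 0 := fun h0 =>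
      hu.fderiv_ne (ContinuousLinearMap.ext fun v => by rw [h2, h0]; simp)
    ext v
    simp only [tangent, contactPlane, LinearMap.mem_ker, ContinuousLinearMap.coe_coe]
    rw [h2, mul_eq_zero, or_iff_left h3]
    simp [contactForm, hz]
  · intro hz
    obtain ⟨u, hu⟩ := hφ.exists_defining p
    refine ⟨u, hu, fun heq => ?_⟩
    have h1 : ((J (φ p).1, 0) : Heis n) ∈ tangent u (φ p) :=
      hu.fderiv_orbit_of_ne_zero hφ hrot (by norm_num) hz (levi_J_self' _)
    rw [heq, contactPlane, LinearMap.mem_ker] at h1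
    have h2 : contactForm (φ p) (J (φ p).1, 0) = levi (φ p).1 (φ p).1 := by
      simp only [contactForm, levi, LinearMap.coe_mk, AddHom.coe_mk, zero_add]
      refine Finset.sum_congr rfl fun j _ => ?_
      simp [J]
    rw [h2] at h1
    exact (levi_self_pos hz).ne' h1

/-- A smooth defining function off the axis is infinitesimally symmetric. -/
theorem IsDefiningAt.exists_isInfSymmetric (hu : IsDefiningAt ∞ φ p u) (hz : (φ p).1 ≠ 0) :
    ∃ W, φ p ∈ W ∧ IsInfSymmetric u W ∧
      ∀ q ∈ W, u q = 0 → ∃ x, IsDefiningAt ∞ φ x u ∧ φ x = q := by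
  obtain ⟨V, W, hV, hp, hWo, hud, hd, he, him⟩ := hu
  have hpW : φ p ∈ {q ∈ W | u q = 0} := him ▸ Set.mem_image_of_mem φ hp
  have hx : ∀ q ∈ W, u q = 0 → ∃ x, IsDefiningAt ∞ φ x u ∧ φ x = q := by
    intro q hqW hq0
    have : q ∈ φ '' V := him ▸ ⟨hqW, hq0⟩
    obtain ⟨x, hx, rfl⟩ := this
    exact ⟨x, ⟨V, W, hV, hx, hWo, hud, hd, he, him⟩, rfl⟩
  have hopen : IsOpen {q : Heis n | q.1 ≠ 0} := isOpen_ne_fun continuous_fst continuous_const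
  refine ⟨W ∩ {q | q.1 ≠ 0}, ⟨hpW.1, hz⟩, ⟨hWo.inter hopen, hud.mono Set.inter_subset_left,
    fun q hq => hd q hq.1, fun q hq => hq.2, fun q hq hq0 w hw => ?_⟩, fun q hq => hx q hq.1⟩
  obtain ⟨x, hxd, rfl⟩ := hx q hq.1 hq0
  exact hxd.fderiv_orbit_of_ne_zero hφ hrot (by exact_mod_cast le_top) hq.2 hw

theorem isUmbilic_of_isRotationallySymmetric (hn : 1 ≤ n) : IsUmbilic φ := by
  intro p hp u hu
  have hz := (isRegular_iff hφ hrot hn).1 hp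
  obtain ⟨W, hpW, hW, -⟩ := hu.exists_isInfSymmetric hφ hrot hz
  exact hW.isUmbilicAt hpW hu.apply_eq_zero

end Symmetric

end Heis

/-! ## Removing isolated points from a connected space -/

/-- Polar coordinates: a continuous image of an interval times the unit sphere, which is connected
when the rank exceeds one. -/
theorem isConnected_ball_diff_zero {K : Type*} [NormedAddCommGroup K] [NormedSpace ℝ K]
    (hK : 1 < Module.rank ℝ K) {δ : ℝ} (hδ : 0 < δ) :
    IsConnected (Metric.ball (0 : K) δ \ {0}) := by
  have h1 : Metric.ball (0 : K) δ \ {0} =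
      (fun x : ℝ × K => x.1 • x.2) '' (Set.Ioo 0 δ ×ˢ Metric.sphere 0 1) := by
    ext y
    simp only [Set.mem_sdiff, mem_ball_zero_iff, Set.mem_singleton_iff, Set.mem_image,
      Set.mem_prod, Set.mem_Ioo, mem_sphere_zero_iff_norm, Prod.exists]
    constructor
    · rintro ⟨hy, hy0⟩
      have hpos : 0 < ‖y‖ := norm_pos_iff.2 hy0
      refine ⟨‖y‖, ‖y‖⁻¹ • y, ⟨⟨hpos, hy⟩, ?_⟩, ?_⟩
      · rw [norm_smul, norm_inv, norm_norm, inv_mul_cancel₀ hpos.ne']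
      · rw [smul_smul, mul_inv_cancel₀ hpos.ne', one_smul]
    · rintro ⟨r, x, ⟨⟨hr0, hr⟩, hx⟩, rfl⟩
      refine ⟨by rwa [norm_smul, hx, mul_one, Real.norm_of_nonneg hr0.le], fun h0 => ?_⟩
      rcases smul_eq_zero.1 h0 with h | h
      · exact hr0.ne' h
      · rw [h, norm_zero] at hx
        exact zero_ne_one hx
  rw [h1]
  exact ((isConnected_Ioo hδ).prod (isConnected_sphere hK 0 zero_le_one)).image _
    (by fun_prop)

/-- In a connected space with connected small punctured neighbourhoods, a set that is clopen off a
discrete closed set is either empty or everything there. -/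
theorem mem_of_clopen_off_discrete {M : Type*} [TopologicalSpace M] [T1Space M] [ConnectedSpace M]
    (hM : ∀ p : M, ∀ N ∈ 𝓝 p, ∃ V ∈ 𝓝 p, V ⊆ N ∧ IsConnected (V \ {p})) {Z D : Set M}
    (hZ : ∀ p ∈ Z, ∀ᶠ x in 𝓝[≠] p, x ∉ Z)
    (hD : ∀ p ∉ Z, (∀ᶠ x in 𝓝 p, x ∈ D) ∨ ∀ᶠ x in 𝓝 p, x ∉ D)
    {p₀ : M} (hp₀ : p₀ ∉ Z) (hp₀D : p₀ ∈ D) {p : M} (hp : p ∉ Z) : p ∈ D := by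
  have hne : ∀ p : M, (𝓝[≠] p).NeBot := by
    intro p
    refine Filter.neBot_iff.2 fun h => ?_
    have h2 : {p} ∈ 𝓝 p := by
      have : (∅ : Set M) ∈ 𝓝[≠] p := h ▸ Filter.mem_bot
      rw [mem_nhdsWithin_iff_eventually] at this
      filter_upwards [this] with x hx
      by_contra hc
      exact hx hc
    obtain ⟨V, -, hVN, hV⟩ := hM p _ h2
    obtain ⟨x, hx, hxp⟩ := hV.nonempty
    exact hxp (hVN hx)
  -- Around a point of `Z`, a connected punctured neighbourhood avoids `Z`, and `D` is clopen in it;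
  -- so `D` either contains it or misses it.
  have hdich : ∀ p, (∀ᶠ x in 𝓝[≠] p, x ∈ D) ∨ ∀ᶠ x in 𝓝[≠] p, x ∈ Dᶜ := by
    intro p
    by_cases hpZ : p ∈ Z
    · have h1 := eventually_nhdsWithin_iff.1 (hZ p hpZ)
      obtain ⟨V, hV, hVN, hVc⟩ := hM p _ h1
      have hcover : V \ {p} ⊆ interior D ∪ interior Dᶜ := by
        rintro x ⟨hx, hxp⟩
        have hxZ : x ∉ Z := hVN hx hxp
        exact (hD x hxZ).imp mem_interior_iff_mem_nhds.2 mem_interior_iff_mem_nhds.2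
      have hdisj : Disjoint (interior D) (interior Dᶜ) :=
        disjoint_compl_right.mono interior_subset interior_subset
      have hmem : V \ {p} ∈ 𝓝[≠] p :=
        Filter.inter_mem (mem_nhdsWithin_of_mem_nhds hV) self_mem_nhdsWithin
      rcases hVc.isPreconnected.subset_or_subset isOpen_interior isOpen_interior hdisj hcover
        with h | h
      · exact Or.inl (Filter.mem_of_superset hmem (h.trans interior_subset))
      · exact Or.inr (Filter.mem_of_superset hmem (h.trans interior_subset))
    · exact (hD p hpZ).imp (fun h => h.filter_mono nhdsWithin_le_nhds)
        fun h => h.filter_mono nhdsWithin_le_nhds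
  have hopen : ∀ S : Set M, IsOpen {p | ∀ᶠ x in 𝓝[≠] p, x ∈ S} := by
    intro S
    rw [isOpen_iff_mem_nhds]
    intro p hp
    obtain ⟨U, hUS, hU, hpU⟩ := eventually_nhds_iff.1 (eventually_nhdsWithin_iff.1 hp)
    filter_upwards [hU.mem_nhds hpU] with x hx
    by_cases hxp : x = p
    · rwa [hxp]
    · exact ((hU.inter isOpen_compl_singleton).mem_nhds ⟨hx, hxp⟩ |> fun h =>
        Filter.mem_of_superset (mem_nhdsWithin_of_mem_nhds h) fun y hy => hUS y hy.1 hy.2)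
  -- Replacing `D` by the points around which it holds off the centre gives a set clopen in all of
  -- `M`, including across `Z`.
  have hclopen : IsClopen {p | ∀ᶠ x in 𝓝[≠] p, x ∈ D} := by
    refine ⟨?_, hopen D⟩
    have : {p | ∀ᶠ x in 𝓝[≠] p, x ∈ D} = {p | ∀ᶠ x in 𝓝[≠] p, x ∈ Dᶜ}ᶜ := by
      ext p
      refine ⟨fun h h' => ?_, fun h => (hdich p).resolve_right h⟩
      have := hne p
      obtain ⟨x, hx, hx'⟩ := (Filter.Eventually.and (show ∀ᶠ x in 𝓝[≠] p, x ∈ D from h) h').exists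
      exact hx' hx
    rw [this]
    exact (hopen Dᶜ).isClosed_compl
  have hnon : p₀ ∈ {p | ∀ᶠ x in 𝓝[≠] p, x ∈ D} :=
    (hD p₀ hp₀).elim (fun h => h.filter_mono nhdsWithin_le_nhds)
      fun h => absurd hp₀D h.self_of_nhds
  have huniv := hclopen.eq_univ ⟨p₀, hnon⟩
  have hpD : ∀ᶠ x in 𝓝[≠] p, x ∈ D :=
    show p ∈ {p | ∀ᶠ x in 𝓝[≠] p, x ∈ D} from huniv ▸ Set.mem_univ p
  rcases hD p hp with h | h
  · exact h.self_of_nhds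
  · have := hne p
    obtain ⟨x, hx, hx'⟩ :=
      (Filter.Eventually.and hpD (h.filter_mono nhdsWithin_le_nhds)).exists
    exact absurd hx hx'

namespace Heis

variable {n : ℕ} {M : Type*} [TopologicalSpace M]

theorem finrank_heis : Module.finrank ℝ (Heis n) = 2 * n + 1 := by
  rw [Module.finrank_prod, finrank_real_of_complex, finrank_euclideanSpace, Fintype.card_fin,
    Module.finrank_self]

/-- Small punctured neighbourhoods in an immersed hypersurface are connected. -/
theorem IsDefiningAt.exists_isConnected_diff (hn : 1 ≤ n) {m : WithTop ℕ∞} {φ : M → Heis n}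
    {p : M} {u : Heis n → ℝ} (h : IsDefiningAt m φ p u) (hm : 1 ≤ m) {N : Set M} (hN : N ∈ 𝓝 p) :
    ∃ V ∈ 𝓝 p, V ⊆ N ∧ IsConnected (V \ {p}) := by
  have hu : ContDiffAt ℝ 1 u (φ p) := h.contDiffAt.of_le hm
  obtain ⟨ε, ψ, hε, hψ0, hψd, hψdiff, hψinj, hψu, hψim⟩ :=
    exists_straightening hu h.apply_eq_zero h.fderiv_ne
  have hφc := h.continuousAt
  have hℓ := h.fderiv_ne
  obtain ⟨V, W, hV, hp, hWo, -, -, he, him⟩ := h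
  set ℓ := fderiv ℝ u (φ p) with hℓdef
  have hpW : φ p ∈ {q ∈ W | u q = 0} := him ▸ Set.mem_image_of_mem φ hp
  let K := LinearMap.ker ℓ.toLinearMap
  have hK : 1 < Module.rank ℝ K := by
    have h1 : Module.finrank ℝ K + 1 = 2 * n + 1 := by
      rw [← finrank_heis]
      refine Module.Dual.finrank_ker_add_one_of_ne_zero (f := ℓ.toLinearMap) fun h0 => hℓ ?_
      exact ContinuousLinearMap.ext fun v => LinearMap.congr_fun h0 v
    rw [← Module.finrank_eq_rank]
    exact_mod_cast (by omega : 1 < Module.finrank ℝ K)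
  have hψt : Filter.Tendsto ψ (𝓝 0) (𝓝 (φ p)) := hψ0 ▸ hψd.continuousAt.tendsto
  obtain ⟨δ₀, hδ₀, hball⟩ := Metric.eventually_nhds_iff_ball.1
    ((hψt.eventually (hWo.mem_nhds hpW.1)).and (Metric.ball_mem_nhds (0 : Heis n) hε))
  have hex : ∀ y : K, y ∈ Metric.ball (0 : K) δ₀ → ∃ x ∈ V, φ x = ψ y := by
    intro y hy
    have hy' : (y : Heis n) ∈ Metric.ball (0 : Heis n) δ₀ := by simpa using hy
    obtain ⟨h1, h2⟩ := hball y hy'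
    have h3 : u (ψ y) = 0 := by rw [hψu _ h2]; exact y.2
    have : ψ y ∈ φ '' V := him ▸ ⟨h1, h3⟩
    exact this
  have : Nonempty M := ⟨p⟩
  -- The sheet is parametrised by a ball in the `2n`-dimensional kernel `K`; continuity of `ζ` comes
  -- from the embedding condition.
  let ζ : K → M := fun y => Function.invFunOn φ V (ψ y)
  have hζV : ∀ y ∈ Metric.ball (0 : K) δ₀, ζ y ∈ V := fun y hy =>
    Function.invFunOn_mem (hex y hy)
  have hφζ : ∀ y ∈ Metric.ball (0 : K) δ₀, φ (ζ y) = ψ y := fun y hy =>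
    Function.invFunOn_eq (hex y hy)
  have hinj : Set.InjOn φ V := Set.injOn_iff_injective.2 he.injective
  have h0mem : (0 : K) ∈ Metric.ball (0 : K) δ₀ := Metric.mem_ball_self hδ₀
  have hζ0 : ζ 0 = p := hinj (hζV 0 h0mem) hp (by rw [hφζ 0 h0mem]; simpa using hψ0)
  have hζc : ContinuousOn ζ (Metric.ball 0 δ₀) := by
    rw [continuousOn_iff_continuous_domRestrict]
    let ζ' : Metric.ball (0 : K) δ₀ → V := fun y => ⟨ζ y, hζV y y.2⟩
    have h1 : Continuous ζ' := by
      rw [he.continuous_iff]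
      have h2 : (fun x : V => φ x) ∘ ζ' = fun y : Metric.ball (0 : K) δ₀ => ψ (y : K) :=
        funext fun y => hφζ y y.2
      rw [h2, continuous_iff_continuousAt]
      intro y
      have hy' : ((y : K) : Heis n) ∈ Metric.ball (0 : Heis n) δ₀ :=
        mem_ball_zero_iff.2 (mem_ball_zero_iff.1 y.2)
      exact ContinuousAt.comp (f := fun y : Metric.ball (0 : K) δ₀ => ((y : K) : Heis n))
        (hψdiff _ (hball _ hy').2).continuousAt (by fun_prop)
    exact continuous_subtype_val.comp h1
  have hζinj : Set.InjOn ζ (Metric.ball 0 δ₀) := by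
    intro y hy y' hy' hyy
    have h1 : ψ y = ψ y' := by rw [← hφζ y hy, ← hφζ y' hy', hyy]
    exact Subtype.ext (hψinj (hball y (by simpa using hy)).2 (hball y' (by simpa using hy')).2 h1)
  have hζat : Filter.Tendsto ζ (𝓝 0) (𝓝 p) := by
    have := hζc.continuousAt (Metric.ball_mem_nhds (0 : K) hδ₀)
    rw [ContinuousAt, hζ0] at this
    exact this
  obtain ⟨δ, hδ, hδball⟩ := Metric.eventually_nhds_iff_ball.1
    ((hζat.eventually hN).and (Metric.ball_mem_nhds (0 : K) hδ₀))
  have hsub : Metric.ball (0 : K) δ ⊆ Metric.ball 0 δ₀ := fun y hy => (hδball y hy).2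
  refine ⟨ζ '' Metric.ball 0 δ, ?_, ?_, ?_⟩
  · have hη : 0 < min δ (min δ₀ ε) := lt_min hδ (lt_min hδ₀ hε)
    filter_upwards [hφc (hψim _ hη ((min_le_right _ _).trans (min_le_right _ _))),
      hV.mem_nhds hp] with x hx hxV
    obtain ⟨y, hy, hyx⟩ := hx
    have hyε : y ∈ Metric.ball (0 : Heis n) ε :=
      Metric.ball_subset_ball ((min_le_right _ _).trans (min_le_right _ _)) hy
    have hx0 : u (φ x) = 0 := by
      have : φ x ∈ {q ∈ W | u q = 0} := him ▸ Set.mem_image_of_mem φ hxV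
      exact this.2
    have hyK : y ∈ K := by
      change ℓ y = 0
      rw [← hψu y hyε, hyx, hx0]
    have hyδ : (⟨y, hyK⟩ : K) ∈ Metric.ball (0 : K) δ := by
      have := Metric.ball_subset_ball (min_le_left _ _) hy
      simpa using this
    exact ⟨⟨y, hyK⟩, hyδ, hinj (hζV _ (hsub hyδ)) hxV (by rw [hφζ _ (hsub hyδ), ← hyx])⟩
  · rintro _ ⟨y, hy, rfl⟩
    exact (hδball y hy).1
  · have : ζ '' Metric.ball 0 δ \ {p} = ζ '' (Metric.ball 0 δ \ {0}) := by
      rw [(hζinj.mono hsub).image_sdiff, ← hζ0]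
      congr 1
      rw [Set.inter_eq_right.2 (Set.singleton_subset_iff.2 (Metric.mem_ball_self hδ)),
        Set.image_singleton]
    rw [this]
    exact (isConnected_ball_diff_zero hK hδ).image ζ
      (hζc.mono (Set.sdiff_subset.trans hsub))

end Heis

namespace Heis

variable {n : ℕ} {M : Type*} [TopologicalSpace M]

/-! ## Independence of the defining function -/

/-- The horizontal normals of two defining functions agree up to sign. -/
theorem IsDefiningAt.exists_sign {m m' : WithTop ℕ∞} {φ : M → Heis n} {p : M} {u u' : Heis n → ℝ}
    (h : IsDefiningAt m φ p u) (h' : IsDefiningAt m' φ p u') (hm : 1 ≤ m) (hm' : 1 ≤ m') :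
    ∃ σ : ℝ, (σ = 1 ∨ σ = -1) ∧ e2n u' (φ p) = σ • e2n u (φ p) := by
  obtain ⟨ν, hν⟩ : ∃ ν, fderiv ℝ u (φ p) ν ≠ 0 := by
    by_contra! hc
    exact h.fderiv_ne (ContinuousLinearMap.ext hc)
  set c := fderiv ℝ u' (φ p) ν / fderiv ℝ u (φ p) ν with hc
  have hmul : ∀ v, fderiv ℝ u' (φ p) v = c * fderiv ℝ u (φ p) v := by
    intro v
    have h1 := h.fderiv_eq_zero h' hm hm'
      (v := v - (fderiv ℝ u (φ p) v / fderiv ℝ u (φ p) ν) • ν) (by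
        rw [map_sub, map_smul, smul_eq_mul]; field_simp; ring)
    rw [map_sub, map_smul, smul_eq_mul] at h1
    rw [hc]
    linear_combination h1
  have hc0 : c ≠ 0 := by
    intro h0
    exact h'.fderiv_ne (ContinuousLinearMap.ext fun v => by rw [hmul, h0]; simp)
  have hgr : hgrad u' (φ p) = c • hgrad u (φ p) := eq_of_levi_eq fun a => by
    rw [levi_hgrad, levi_smul_left, levi_hgrad, hmul]
  refine ⟨c / |c|, ?_, ?_⟩
  · rcases lt_or_gt_of_ne hc0 with h0 | h0
    · right; rw [abs_of_neg h0]; field_simp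
    · left; rw [abs_of_pos h0]; field_simp
  · rw [e2n, e2n, hgr, norm_smul, Real.norm_eq_abs, smul_smul, smul_smul]
    congr 1
    rw [mul_inv]
    ring

/-- The normal is determined up to sign and `κ²` is even in it. -/
theorem IsDefiningAt.kappaSq_eq {m m' : WithTop ℕ∞} {φ : M → Heis n} {p : M} {u u' : Heis n → ℝ}
    (h : IsDefiningAt m φ p u) (h' : IsDefiningAt m' φ p u') (hm : 1 ≤ m) (hm' : 1 ≤ m') :
    kappaSq u' (φ p) = kappaSq u (φ p) := by
  obtain ⟨σ, hσ, he⟩ := h.exists_sign h' hm hm'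
  rw [kappaSq, kappaSq, normalRad, normalRad, he, levi_smul_left]
  rcases hσ with rfl | rfl <;> ring

/-- The normal enters only through `Q/P` and `QP`, which do not see its sign. -/
theorem IsDefiningAt.centre_eq {m m' : WithTop ℕ∞} {φ : M → Heis n} {p : M} {u u' : Heis n → ℝ}
    (h : IsDefiningAt m φ p u) (h' : IsDefiningAt m' φ p u') (hm : 1 ≤ m) (hm' : 1 ≤ m')
    (lam : ℝ) : centre lam u' (φ p) = centre lam u (φ p) := by
  obtain ⟨σ, hσ, he⟩ := h.exists_sign h' hm hm'
  rw [centre, centre, normalRad, normalRad, normalHopf, normalHopf, he, levi_smul_left,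
    levi_smul_left]
  rcases hσ with rfl | rfl
  · simp
  · rw [neg_one_mul, neg_one_mul, neg_div_neg_eq, neg_mul_neg]

/-! ## The first integrals on the hypersurface -/

/-- The Pansu sphere osculating the hypersurface at `p` has parameter `lam` and centre `(0, c)`. -/
def HasOsculatingSphere (φ : M → Heis n) (lam c : ℝ) (p : M) : Prop :=
  ∃ u : Heis n → ℝ, IsDefiningAt ∞ φ p u ∧ kappaSq u (φ p) = lam ^ 2 ∧ centre lam u (φ p) = c

theorem mem_vertTranslate_pansuSphere {lam c : ℝ} {q : Heis n} :
    q ∈ vertTranslate c '' pansuSphere n lam ↔ ‖q.1‖ ≤ 1 / lam ∧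
      (q.2 - c = pansuProfile lam ‖q.1‖ ∨ q.2 - c = -pansuProfile lam ‖q.1‖) := by
  constructor
  · rintro ⟨q, ⟨h1, h2⟩, rfl⟩
    refine ⟨h1, ?_⟩
    simpa [vertTranslate] using h2
  · rintro ⟨h1, h2⟩
    exact ⟨(q.1, q.2 - c), ⟨h1, h2⟩, by simp [vertTranslate]⟩

/-- From `|P| = λr²` and `P² + Q² = r²` one gets `cos(arctan(Q/P)) = λr` and `√(1 - λ²r²) = |Q|/r`.
The equation for the centre then becomes that of the profile, with the sign of `Q/P` selecting the
upper or lower half. -/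
theorem IsInfSymmetric.mem_pansuSphere {u : Heis n → ℝ} {W : Set (Heis n)} {q : Heis n}
    (h : IsInfSymmetric u W) (hq : q ∈ W) (h0 : u q = 0) {lam c : ℝ} (hlam : 0 < lam)
    (hk : kappaSq u q = lam ^ 2) (hc : centre lam u q = c) :
    q ∈ vertTranslate c '' pansuSphere n lam := by
  have hρ := h.levi_fst_pos hq
  have hsq := h.normalRad_sq_add hq h0
  rw [kappaSq] at hk
  rw [centre] at hc
  set P := normalRad u q
  set Q := normalHopf u q
  rw [levi_self] at hρ hsq hk hc
  set r := ‖q.1‖ with hr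
  have hr0 : 0 < r := norm_pos_iff.2 (h.ne_zero q hq)
  have hP : |P| = lam * r ^ 2 := by
    have h1 : P ^ 2 = (lam * r ^ 2) ^ 2 := by
      field_simp at hk; linarith
    rw [← sq_eq_sq₀ (abs_nonneg _) (by positivity), sq_abs, h1]
  have hPpos : 0 < |P| := by rw [hP]; positivity
  have hP0 : P ≠ 0 := abs_pos.1 hPpos
  have hle : |P| ≤ r := by
    rw [← sq_le_sq₀ (abs_nonneg _) hr0.le, sq_abs]; nlinarith [sq_nonneg Q]
  have hlr : lam * r = |P| / r := by rw [hP]; field_simp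
  have hlr1 : lam * r ≤ 1 := by rw [hlr, div_le_one hr0]; exact hle
  have hcos : Real.cos (Real.arctan (Q / P)) = lam * r := by
    rw [Real.cos_arctan, hlr]
    have h1 : 1 + (Q / P) ^ 2 = (r / |P|) ^ 2 := by
      rw [div_pow, div_pow, sq_abs]; field_simp; linarith
    rw [h1, Real.sqrt_sq (by positivity), one_div_div]
  have hsqrt : Real.sqrt (1 - lam ^ 2 * r ^ 2) = |Q| / r := by
    have h1 : 1 - lam ^ 2 * r ^ 2 = (|Q| / r) ^ 2 := by
      have : lam ^ 2 * r ^ 2 = (|P| / r) ^ 2 := by rw [← hlr]; ring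
      rw [this, div_pow, div_pow, sq_abs, sq_abs]; field_simp; linarith
    rw [h1, Real.sqrt_sq (by positivity)]
  rw [mem_vertTranslate_pansuSphere]
  refine ⟨by rw [le_div_iff₀ hlam]; linarith, ?_⟩
  have habs : |Q| * |P| / r ^ 2 = lam * |Q| := by rw [hP]; field_simp
  have hprod : lam * r * (|Q| / r) = lam * |Q| := by field_simp
  have hpi := Real.arctan_lt_pi_div_two (Q / P)
  have hpi' := Real.neg_pi_div_two_lt_arctan (Q / P)
  have hpos := Real.pi_pos
  rw [pansuProfile, hsqrt, hprod, ← hcos]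
  rcases le_total (Q / P) 0 with hs | hs
  · left
    have h1 : Real.arctan (Q / P) ≤ 0 := by
      rw [← Real.arctan_zero]; exact Real.arctan_strictMono.monotone hs
    have h2 : Q * P = -(|Q| * |P|) := by
      have : Q * P = Q / P * P ^ 2 := by field_simp
      rw [← abs_mul, abs_of_nonpos, neg_neg]
      rw [this]
      exact mul_nonpos_of_nonpos_of_nonneg hs (sq_nonneg _)
    rw [← Real.cos_neg, Real.arccos_cos (by linarith) (by linarith)]
    rw [h2, neg_div, habs] at hc
    linarith
  · right
    have h1 : 0 ≤ Real.arctan (Q / P) := by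
      rw [← Real.arctan_zero]; exact Real.arctan_strictMono.monotone hs
    have h2 : Q * P = |Q| * |P| := by
      have : Q * P = Q / P * P ^ 2 := by field_simp
      rw [← abs_mul, abs_of_nonneg]
      rw [this]
      exact mul_nonneg hs (sq_nonneg _)
    rw [Real.arccos_cos h1 (by linarith)]
    rw [h2, habs] at hc
    linarith

theorem continuous_pansuProfile (lam : ℝ) : Continuous (pansuProfile lam) := by
  unfold pansuProfile
  fun_prop

theorem isClosed_pansuSphere (lam c : ℝ) :
    IsClosed (vertTranslate c '' pansuSphere n lam) := by
  have : vertTranslate c '' pansuSphere n lam = {q : Heis n | ‖q.1‖ ≤ 1 / lam ∧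
      (q.2 - c = pansuProfile lam ‖q.1‖ ∨ q.2 - c = -pansuProfile lam ‖q.1‖)} :=
    Set.ext fun q => mem_vertTranslate_pansuSphere
  rw [this]
  have hp : Continuous fun q : Heis n => pansuProfile lam ‖q.1‖ :=
    (continuous_pansuProfile lam).comp continuous_fst.norm
  refine IsClosed.inter (isClosed_le continuous_fst.norm continuous_const) (IsClosed.union ?_ ?_)
  · exact isClosed_eq (by fun_prop) hp
  · exact isClosed_eq (by fun_prop) hp.neg

section Symmetric

variable [SecondCountableTopology M] {φ : M → Heis n} (hφ : IsImmersedHypersurface φ)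
  (hrot : IsRotationallySymmetric φ) (hn : 1 ≤ n) {p : M}

include hφ hn in
omit [SecondCountableTopology M] in
theorem IsImmersedHypersurface.neBot_nhdsNE (p : M) : (𝓝[≠] p).NeBot := by
  obtain ⟨u, hu⟩ := hφ.exists_defining p
  refine Filter.neBot_iff.2 fun h => ?_
  have h1 : (∅ : Set M) ∈ 𝓝[≠] p := h ▸ Filter.mem_bot
  rw [mem_nhdsWithin_iff_eventually] at h1
  obtain ⟨V, -, hVN, hV⟩ := hu.exists_isConnected_diff hn (by norm_num) h1
  obtain ⟨x, hx, hxp⟩ := hV.nonempty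
  exact hVN hx hxp

include hφ hrot hn

/-- The vertical derivative of a defining function does not vanish on the axis. -/
theorem IsDefiningAt.fderiv_vert_ne {m : WithTop ℕ∞} {u : Heis n → ℝ} (hu : IsDefiningAt m φ p u)
    (hm : 1 ≤ m) (hz : (φ p).1 = 0) : fderiv ℝ u (φ p) (0, 1) ≠ 0 := by
  intro h0
  refine hu.fderiv_ne (ContinuousLinearMap.ext fun v => ?_)
  have h1 := hu.fderiv_of_eq_zero hφ hrot hn hm hz v.1
  have : v = (v.1, 0) + v.2 • ((0 : CVec n), (1 : ℝ)) := by ext <;> simp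
  rw [this, map_add, map_smul, h1, h0]
  simp

/-- The points on the axis are isolated. -/
theorem eventually_fst_ne_zero (hz : (φ p).1 = 0) : ∀ᶠ x in 𝓝[≠] p, (φ x).1 ≠ 0 := by
  obtain ⟨u, hu⟩ := hφ.exists_defining p
  have hd := hu.fderiv_vert_ne hφ hrot hn (by norm_num) hz
  have hq : φ p = (0, (φ p).2) := Prod.ext hz rfl
  -- Restricted to the axis, `u` has nonzero derivative at `φ p`, so no other zero of `u` on the
  -- axis is close by.
  have h1 : HasDerivAt (fun s : ℝ => u (0, s)) (fderiv ℝ u (φ p) (0, 1)) (φ p).2 := by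
    have h2 : HasFDerivAt u (fderiv ℝ u (φ p)) ((0 : CVec n), (φ p).2) := by
      rw [← hq]; exact (hu.contDiffAt.differentiableAt (by norm_num)).hasFDerivAt
    exact h2.comp_hasDerivAt _ ((hasDerivAt_const (φ p).2 (0 : CVec n)).prodMk (hasDerivAt_id _))
  have h3 : ∀ᶠ s in 𝓝 (φ p).2, s ≠ (φ p).2 → u (0, s) ≠ 0 :=
    eventually_nhdsWithin_iff.1 (h1.eventually_ne hd)
  obtain ⟨V, hV, hinj⟩ := hu.exists_injOn
  have hsnd : Filter.Tendsto (fun x => (φ x).2) (𝓝 p) (𝓝 (φ p).2) :=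
    (continuous_snd.tendsto _).comp hu.continuousAt
  rw [eventually_nhdsWithin_iff]
  filter_upwards [hsnd.eventually h3, hV, hu.eventually] with x hx hxV hxu hxp hx0
  have hφx : φ x = (0, (φ x).2) := Prod.ext hx0 rfl
  have h4 : (φ x).2 = (φ p).2 := by
    by_contra hne
    refine hx hne ?_
    rw [← hφx]
    exact hxu.apply_eq_zero
  exact hxp (hinj hxV (mem_of_mem_nhds hV) (by rw [hφx, hq, h4]))

theorem exists_smooth_defining_of_ne_zero (hz : (φ p).1 ≠ 0) : ∃ u, IsDefiningAt ∞ φ p u :=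
  hφ.exists_smooth_defining p ((isRegular_iff hφ hrot hn).2 hz)

/-- The equation `l = 2k` in terms of the horizontal normal. -/
theorem ell_eq (hl : LEqTwoK φ) {u : Heis n → ℝ} (hu : IsDefiningAt ∞ φ p u)
    (hz : (φ p).1 ≠ 0) :
    ell u (φ p) = 2 * -(normalRad u (φ p) / levi (φ p).1 (φ p).1) := by
  obtain ⟨W, hpW, hW, -⟩ := hu.exists_isInfSymmetric hφ hrot hz
  exact hl p ((isRegular_iff hφ hrot hn).2 hz) u hu _ (hW.isCommonEigenvalue hpW hu.apply_eq_zero)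

/-- Both integrals are locally constant on the sheet, but the centre is one only where `κ² = λ²`,
hence the case distinction. -/
theorem hasOsculatingSphere_clopen (hl : LEqTwoK φ) {lam : ℝ} (hlam : lam ≠ 0) (c : ℝ)
    (hz : (φ p).1 ≠ 0) : (∀ᶠ x in 𝓝 p, HasOsculatingSphere φ lam c x) ∨
      ∀ᶠ x in 𝓝 p, ¬HasOsculatingSphere φ lam c x := by
  obtain ⟨u, hu⟩ := exists_smooth_defining_of_ne_zero hφ hrot hn hz
  obtain ⟨W, hpW, hW, hWx⟩ := hu.exists_isInfSymmetric hφ hrot hz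
  have hlW : ∀ q ∈ W, u q = 0 → ell u q = 2 * -(normalRad u q / levi q.1 q.1) := by
    intro q hqW hq0
    obtain ⟨x, hx, rfl⟩ := hWx q hqW hq0
    exact ell_eq hφ hrot hn hl hx (hW.ne_zero _ hqW)
  have hWn := hW.isOpen.mem_nhds hpW
  have hone : (1 : WithTop ℕ∞) ≤ ∞ := by exact_mod_cast le_top
  have hkappa : ∀ᶠ q in 𝓝 (φ p), u q = 0 → kappaSq u q = kappaSq u (φ p) := by
    refine eventually_eq_of_fderiv_eq_zero (hW.contDiffAt_one hpW) hu.apply_eq_zero hu.fderiv_ne ?_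
    filter_upwards [hWn] with q hqW hq0
    exact hW.fderiv_kappaSq hqW hq0 (hlW q hqW hq0)
  have hpull : ∀ {A : Heis n → Prop}, (∀ᶠ q in 𝓝 (φ p), u q = 0 → A q) →
      ∀ᶠ x in 𝓝 p, IsDefiningAt ∞ φ x u ∧ A (φ x) := by
    intro A hA
    filter_upwards [hu.eventually, hu.continuousAt.eventually hA] with x hx hxA
    exact ⟨hx, hxA hx.apply_eq_zero⟩
  by_cases hk : kappaSq u (φ p) = lam ^ 2
  · have hcentre : ∀ᶠ q in 𝓝 (φ p), u q = 0 → centre lam u q = centre lam u (φ p) := by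
      refine eventually_eq_of_fderiv_eq_zero (hW.contDiffAt_one hpW) hu.apply_eq_zero
        hu.fderiv_ne ?_
      filter_upwards [hWn, hkappa] with q hqW hqk hq0
      exact hW.fderiv_centre hqW hq0 (hlW q hqW hq0) hlam (by rw [hqk hq0, hk])
    by_cases hc : centre lam u (φ p) = c
    · left
      filter_upwards [hpull hkappa, hpull hcentre] with x hx1 hx2
      exact ⟨u, hx1.1, by rw [hx1.2, hk], by rw [hx2.2, hc]⟩
    · right
      filter_upwards [hpull hcentre] with x hx
      rintro ⟨u', hu', -, hc'⟩
      rw [hx.1.centre_eq hu' hone hone, hx.2] at hc'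
      exact hc hc'
  · right
    filter_upwards [hpull hkappa] with x hx
    rintro ⟨u', hu', hk', -⟩
    rw [hx.1.kappaSq_eq hu' hone hone, hx.2] at hk'
    exact hk hk'

omit hn in
/-- At a point of maximal distance to the axis the normal is radial. -/
theorem kappaSq_of_isMax {u : Heis n → ℝ} (hu : IsDefiningAt ∞ φ p u) (hz : (φ p).1 ≠ 0)
    (hmax : ∀ x, ‖(φ x).1‖ ≤ ‖(φ p).1‖) : kappaSq u (φ p) = (1 / ‖(φ p).1‖) ^ 2 := by
  obtain ⟨W, hpW, hW, hWx⟩ := hu.exists_isInfSymmetric hφ hrot hz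
  have hu0 := hu.apply_eq_zero
  have hker : fderiv ℝ u (φ p) (hor (φ p) (en u (φ p))) = 0 := by
    rw [← levi_hgrad, en, e2n, levi_neg_right, map_smul, levi_smul_right, levi_J_self]
    simp
  obtain ⟨γ, hγ0, hγd, hγu⟩ :=
    exists_curve_of_mem_ker (hW.contDiffAt_one hpW) hu0 hu.fderiv_ne hker
  have h1 : HasDerivAt (fun s => (γ s).1) (en u (φ p)) 0 :=
    (ContinuousLinearMap.fst ℝ (CVec n) ℝ).hasFDerivAt.comp_hasDerivAt 0 hγd
  have h2 := (hasFDerivAt_levi h1.hasFDerivAt h1.hasFDerivAt).hasDerivAt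
  -- The curve leaves along `en`, where the derivative of `|z|²` is `2Q`; maximality forces `Q = 0`.
  have hloc : IsLocalMax (fun s => levi (γ s).1 (γ s).1) 0 := by
    have hγt : Filter.Tendsto γ (𝓝 0) (𝓝 (φ p)) := hγ0 ▸ hγd.continuousAt.tendsto
    filter_upwards [hγu, hγt.eventually (hW.isOpen.mem_nhds hpW)] with s hs hsW
    obtain ⟨x, -, hx⟩ := hWx _ hsW hs
    rw [← hx, hγ0, levi_self, levi_self]
    exact pow_le_pow_left₀ (norm_nonneg _) (hmax x) 2
  have h3 := hloc.hasDerivAt_eq_zero h2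
  simp only [_root_.add_apply, ContinuousLinearMap.comp_apply, ContinuousLinearMap.flip_apply,
    leviL_apply, hγ0, ContinuousLinearMap.toSpanSingleton_apply, one_smul] at h3
  rw [levi_comm (φ p).1, levi_en_fst] at h3
  have hQ : normalHopf u (φ p) = 0 := by linarith
  have hsq := hW.normalRad_sq_add hpW hu0
  have hρ := hW.levi_fst_pos hpW
  rw [kappaSq]
  rw [hQ] at hsq
  rw [levi_self] at hsq hρ ⊢
  have : normalRad u (φ p) ^ 2 = ‖(φ p).1‖ ^ 2 := by linarith
  rw [this]
  field_simp

/-- The image of a closed hypersurface with `l = 2k` is contained in a Pansu sphere. -/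
theorem exists_hasOsculatingSphere [T2Space M] [CompactSpace M] [ConnectedSpace M]
    (hl : LEqTwoK φ) : ∃ lam c : ℝ, 0 < lam ∧
      (∀ p, (φ p).1 ≠ 0 → HasOsculatingSphere φ lam c p) ∧
      ∀ p, φ p ∈ vertTranslate c '' pansuSphere n lam := by
  have hcont := hφ.continuous
  obtain ⟨p₀, -, hp₀⟩ := isCompact_univ.exists_isMaxOn (Set.univ_nonempty (α := M))
    (f := fun x => ‖(φ x).1‖) (by fun_prop)
  have hmax : ∀ x, ‖(φ x).1‖ ≤ ‖(φ p₀).1‖ := fun x => hp₀ (Set.mem_univ x)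
  have hz₀ : (φ p₀).1 ≠ 0 := by
    intro h0
    have := hφ.neBot_nhdsNE hn p₀
    obtain ⟨x, hx⟩ := (eventually_fst_ne_zero hφ hrot hn h0).exists
    have := hmax x
    rw [h0, norm_zero] at this
    exact hx (norm_le_zero_iff.1 this)
  obtain ⟨u₀, hu₀⟩ := exists_smooth_defining_of_ne_zero hφ hrot hn hz₀
  set lam := 1 / ‖(φ p₀).1‖ with hlam
  have hlam0 : 0 < lam := by positivity
  set c := centre lam u₀ (φ p₀) with hc
  have hosc₀ : HasOsculatingSphere φ lam c p₀ :=
    ⟨u₀, hu₀, kappaSq_of_isMax hφ hrot hu₀ hz₀ hmax, rfl⟩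
  have hosc : ∀ p, (φ p).1 ≠ 0 → HasOsculatingSphere φ lam c p := by
    intro p hp
    -- The discrete set removed is the set of points on the axis.
    refine mem_of_clopen_off_discrete (Z := {p | (φ p).1 = 0})
      (D := {p | HasOsculatingSphere φ lam c p}) (fun p N hN => ?_) (fun p hp => ?_)
      (fun p hp => ?_) (p₀ := p₀) hz₀ hosc₀ hp
    · obtain ⟨u, hu⟩ := hφ.exists_defining p
      exact hu.exists_isConnected_diff hn (by norm_num) hN
    · exact eventually_fst_ne_zero hφ hrot hn hp
    · exact hasOsculatingSphere_clopen hφ hrot hn hl hlam0.ne' c hp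
  have hmem : ∀ p, (φ p).1 ≠ 0 → φ p ∈ vertTranslate c '' pansuSphere n lam := by
    intro p hp
    obtain ⟨u, hu, hk, hc⟩ := hosc p hp
    obtain ⟨W, hpW, hW, -⟩ := hu.exists_isInfSymmetric hφ hrot hp
    exact hW.mem_pansuSphere hpW hu.apply_eq_zero hlam0 hk hc
  refine ⟨lam, c, hlam0, hosc, fun p => ?_⟩
  by_cases hp : (φ p).1 = 0
  · have := hφ.neBot_nhdsNE hn p
    exact (isClosed_pansuSphere lam c).mem_of_tendsto
      ((hcont.tendsto p).mono_left nhdsWithin_le_nhds)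
      ((eventually_fst_ne_zero hφ hrot hn hp).mono hmem)
  · exact hmem p hp

end Symmetric

end Heis

/-! ## Injectivity of covering maps over a simply connected chart -/

/-- A covering map is injective over a simply connected open chart whose preimage remains
connected, in the sense that it is the complement of a discrete set of a space with connected small
punctured neighbourhoods. -/
theorem IsCoveringMap.injOn_preimage_range {M X A : Type*} [TopologicalSpace M]
    [TopologicalSpace X] [TopologicalSpace A] [T2Space M] [ConnectedSpace M]
    [SimplyConnectedSpace A] [LocallyPathConnectedSpace A] {φ : M → X} (hφ : IsCoveringMap φ)
    {f : A → X} (hf : Topology.IsOpenEmbedding f)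
    (hM : ∀ p : M, ∀ N ∈ 𝓝 p, ∃ V ∈ 𝓝 p, V ⊆ N ∧ IsConnected (V \ {p}))
    (hZ : ∀ p, φ p ∉ Set.range f → ∀ᶠ x in 𝓝[≠] p, φ x ∈ Set.range f) :
    Set.InjOn φ (φ ⁻¹' Set.range f) := by
  intro x₀ hx₀ x₁ hx₁ hxx
  obtain ⟨a₀, ha₀⟩ := hx₀
  obtain ⟨F, ⟨hFa, hF⟩, -⟩ :=
    hφ.existsUnique_continuousMap_lifts ⟨f, hf.continuous⟩ a₀ x₀ ha₀.symm
  have hφF : ∀ a, φ (F a) = f a := fun a => congr_fun hF a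
  have : Nonempty A := ⟨a₀⟩
  let e := hf.toOpenPartialHomeomorph f
  have hsymm : ∀ a, e.symm (f a) = a := fun a => e.left_inv (Set.mem_univ a)
  have htarget : ∀ y, y ∈ e.target ↔ y ∈ Set.range f := fun y => by
    rw [Topology.IsOpenEmbedding.toOpenPartialHomeomorph_target]
  -- Project and come back through the section `F`: the range of `F` is the fixed point set of `g`.
  -- It is open because `φ` is locally injective, and its complement over the chart is open because
  -- `M` is Hausdorff.
  let g : M → M := fun x => F (e.symm (φ x))
  have hg : ∀ x, φ x ∈ Set.range f → φ (g x) = φ x := by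
    rintro x ⟨a, ha⟩
    simp only [g, ← ha, hsymm, hφF]
  have hgc : ∀ x, φ x ∈ Set.range f → ContinuousAt g x := fun x hx =>
    F.continuous.continuousAt.comp
      ((e.continuousAt_symm ((htarget _).2 hx)).comp hφ.continuous.continuousAt)
  have hD : ∀ x, φ x ∈ Set.range f → (x ∈ Set.range F ↔ g x = x) := by
    intro x hx
    constructor
    · rintro ⟨a, rfl⟩
      simp only [g, hφF, hsymm]
    · intro h
      exact ⟨_, h⟩
  have hnear : ∀ x, φ x ∈ Set.range f → ∀ᶠ y in 𝓝 x, φ y ∈ Set.range f := fun x hx =>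
    hφ.continuous.continuousAt.eventually_mem (hf.isOpen_range.mem_nhds hx)
  have key : ∀ x, φ x ∈ Set.range f → x ∈ Set.range F := by
    intro x hx
    refine mem_of_clopen_off_discrete hM (Z := {x | φ x ∉ Set.range f}) (D := Set.range F)
      (fun p hp => (hZ p hp).mono fun x hx h => h hx) (fun p hp => ?_) (p₀ := x₀)
      (fun h => h ⟨a₀, ha₀⟩) ⟨a₀, hFa⟩ (fun h => h hx)
    have hp' : φ p ∈ Set.range f := not_not.1 hp
    by_cases hgp : g p = p
    · left
      obtain ⟨U, hU, hinj⟩ : ∃ U ∈ 𝓝 p, Set.InjOn φ U := by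
        obtain ⟨e', he', rfl⟩ := hφ.isLocalHomeomorph p
        exact ⟨e'.source, e'.open_source.mem_nhds he', e'.injOn⟩
      have h1 : ∀ᶠ y in 𝓝 p, g y ∈ U := (hgc p hp').eventually_mem (by rwa [hgp])
      filter_upwards [h1, hU, hnear p hp'] with y hy1 hy2 hy3
      exact (hD y hy3).2 (hinj hy1 hy2 (hg y hy3))
    · right
      have h1 : ∀ᶠ y in 𝓝 p, g y ≠ y :=
        ((hgc p hp').prodMk continuousAt_id).eventually_mem
          ((isOpen_ne_fun continuous_fst continuous_snd).mem_nhds hgp)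
      filter_upwards [h1, hnear p hp'] with y hy1 hy2 hy3
      exact hy1 ((hD y hy2).1 hy3)
  have h0 := (hD x₀ ⟨a₀, ha₀⟩).1 (key x₀ ⟨a₀, ha₀⟩)
  have h1 := (hD x₁ hx₁).1 (key x₁ hx₁)
  rw [← h0, ← h1]
  simp only [g, hxx]

namespace Heis

variable {n : ℕ}

/-! ## Charts of the Pansu sphere -/

/-- The height on the Pansu sphere as a function of the latitude, up to scaling. -/
def pansuHeight (θ : ℝ) : ℝ := θ + Real.sin θ * Real.cos θ

theorem pansuHeight_neg (θ : ℝ) : pansuHeight (-θ) = -pansuHeight θ := by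
  simp [pansuHeight]; ring

theorem continuous_pansuHeight : Continuous pansuHeight := by
  unfold pansuHeight; fun_prop

/-- The derivative is `1 + cos² θ - sin² θ = 2 cos² θ`. -/
theorem strictMonoOn_pansuHeight :
    StrictMonoOn pansuHeight (Set.Icc (-(Real.pi / 2)) (Real.pi / 2)) := by
  refine strictMonoOn_of_deriv_pos (convex_Icc _ _) continuous_pansuHeight.continuousOn
    fun θ hθ => ?_
  rw [interior_Icc] at hθ
  have h1 : HasDerivAt pansuHeight (1 + (Real.cos θ * Real.cos θ + Real.sin θ * -Real.sin θ)) θ :=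
    (hasDerivAt_id θ).add ((Real.hasDerivAt_sin θ).mul (Real.hasDerivAt_cos θ))
  rw [h1.deriv]
  have h2 := Real.cos_pos_of_mem_Ioo ⟨hθ.1, hθ.2⟩
  nlinarith [Real.sin_sq_add_cos_sq θ]

/-- The latitude `θ = arccos(λr)` uniformises the profile; as `pansuHeight` is odd, negative
latitudes describe the lower half. -/
theorem pansuProfile_eq {lam r : ℝ} (h0 : 0 ≤ lam * r) (h1 : lam * r ≤ 1) :
    pansuProfile lam r = 1 / (2 * lam ^ 2) * pansuHeight (Real.arccos (lam * r)) := by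
  rw [pansuProfile, pansuHeight, Real.sin_arccos, Real.cos_arccos (by linarith) h1, mul_pow]
  ring

theorem pansuProfile_cos {lam θ : ℝ} (hlam : 0 < lam) (h0 : 0 ≤ θ) (h1 : θ ≤ Real.pi / 2) :
    pansuProfile lam (Real.cos θ / lam) = 1 / (2 * lam ^ 2) * pansuHeight θ := by
  have h2 : lam * (Real.cos θ / lam) = Real.cos θ := by field_simp
  have := Real.pi_pos
  rw [pansuProfile_eq (by rw [h2]; exact Real.cos_nonneg_of_mem_Icc ⟨by linarith, h1⟩)
    (by rw [h2]; exact Real.cos_le_one θ), h2, Real.arccos_cos h0 (by linarith)]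

theorem strictAntiOn_pansuProfile {lam : ℝ} (hlam : 0 < lam) :
    StrictAntiOn (pansuProfile lam) (Set.Icc 0 (1 / lam)) := by
  have hb : ∀ r ∈ Set.Icc 0 (1 / lam), 0 ≤ lam * r ∧ lam * r ≤ 1 := by
    rintro r ⟨h0, h1⟩
    rw [le_div_iff₀ hlam] at h1
    exact ⟨by positivity, by linarith⟩
  have hacos : ∀ x, 0 ≤ x → Real.arccos x ∈ Set.Icc (-(Real.pi / 2)) (Real.pi / 2) := fun x hx =>
    ⟨by linarith [Real.arccos_nonneg x, Real.pi_pos], Real.arccos_le_pi_div_two.2 hx⟩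
  intro r hr s hs hrs
  obtain ⟨hr0, hr1⟩ := hb r hr
  obtain ⟨hs0, hs1⟩ := hb s hs
  rw [pansuProfile_eq hr0 hr1, pansuProfile_eq hs0 hs1]
  refine mul_lt_mul_of_pos_left (strictMonoOn_pansuHeight (hacos _ hs0) (hacos _ hr0) ?_)
    (by positivity)
  exact Real.strictAntiOn_arccos ⟨by linarith, hr1⟩ ⟨by linarith, hs1⟩
    (mul_lt_mul_of_pos_left hrs hlam)

theorem pansuProfile_zero (lam : ℝ) : pansuProfile lam 0 = Real.pi / (4 * lam ^ 2) := by
  simp [pansuProfile]; ring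

theorem pansuProfile_nonneg {lam r : ℝ} (hlam : 0 < lam) (hr : 0 ≤ r) :
    0 ≤ pansuProfile lam r := by
  have := Real.arccos_nonneg (lam * r)
  rw [pansuProfile]
  positivity

/-- The poles of the Pansu sphere of parameter `lam` and centre `(0, c)`: the upper one for
`σ = 1`, the lower one for `σ = -1`. -/
def pansuPole (n : ℕ) (σ lam c : ℝ) : Heis n := (0, c + σ * (Real.pi / (4 * lam ^ 2)))

/-- The chart of the Pansu sphere which maps the ball of radius `π` to the complement of the pole
of index `σ`. -/
def pansuChart (σ lam c : ℝ) (w : CVec n) : Heis n :=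
  ((Real.sinc ‖w‖ / lam) • w, c + σ * (1 / (2 * lam ^ 2) * pansuHeight (‖w‖ - Real.pi / 2)))

theorem continuous_pansuChart (σ lam c : ℝ) : Continuous (pansuChart σ lam c (n := n)) := by
  have h1 : Continuous fun w : CVec n => Real.sinc ‖w‖ := Real.continuous_sinc.comp continuous_norm
  have h2 : Continuous fun w : CVec n => pansuHeight (‖w‖ - Real.pi / 2) :=
    continuous_pansuHeight.comp (continuous_norm.sub continuous_const)
  unfold pansuChart
  fun_prop

theorem sinc_mul_self (x : ℝ) : Real.sinc x * x = Real.sin x := by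
  by_cases h : x = 0
  · simp [h]
  · rw [Real.sinc_of_ne_zero h, div_mul_cancel₀ _ h]

/-- The latitude is `‖w‖ - π/2`, and `sinc` keeps the chart continuous at the pole `w = 0`. -/
theorem norm_pansuChart_fst {σ lam c : ℝ} (hlam : 0 < lam) {w : CVec n} (hw : ‖w‖ ≤ Real.pi) :
    ‖(pansuChart σ lam c w).1‖ = Real.cos (‖w‖ - Real.pi / 2) / lam := by
  have h1 : 0 ≤ Real.sin ‖w‖ := Real.sin_nonneg_of_nonneg_of_le_pi (norm_nonneg w) hw
  rw [Real.cos_sub_pi_div_two]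
  change ‖(Real.sinc ‖w‖ / lam) • w‖ = _
  rw [norm_smul, Real.norm_eq_abs, abs_div, abs_of_pos hlam, div_mul_eq_mul_div]
  congr 1
  rw [← abs_of_nonneg (norm_nonneg w), ← abs_mul, abs_of_nonneg (norm_nonneg w), sinc_mul_self,
    abs_of_nonneg h1]

theorem pansuChart_mem {σ lam c : ℝ} (hσ : σ = 1 ∨ σ = -1) (hlam : 0 < lam) {w : CVec n}
    (hw : ‖w‖ ≤ Real.pi) : pansuChart σ lam c w ∈ vertTranslate c '' pansuSphere n lam := by
  rw [mem_vertTranslate_pansuSphere, norm_pansuChart_fst hlam hw]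
  have hw0 := norm_nonneg w
  set θ := ‖w‖ - Real.pi / 2 with hθ
  have hsnd : (pansuChart σ lam c w).2 - c = σ * (1 / (2 * lam ^ 2) * pansuHeight θ) := by
    simp [pansuChart, hθ]
  rw [hsnd]
  refine ⟨div_le_div_of_nonneg_right (Real.cos_le_one θ) hlam.le, ?_⟩
  rcases le_total 0 θ with h | h
  · rw [pansuProfile_cos hlam h (by linarith)]
    rcases hσ with rfl | rfl
    · left; ring
    · right; ring
  · rw [← Real.cos_neg, pansuProfile_cos hlam (by linarith) (by linarith), pansuHeight_neg]
    rcases hσ with rfl | rfl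
    · right; ring
    · left; ring

theorem pansuChart_of_norm_eq_pi {σ lam c : ℝ} {w : CVec n} (hw : ‖w‖ = Real.pi) :
    pansuChart σ lam c w = pansuPole n σ lam c := by
  have h1 : Real.sinc Real.pi = 0 := by
    rw [Real.sinc_of_ne_zero Real.pi_ne_zero, Real.sin_pi, zero_div]
  have h2 : Real.pi - Real.pi / 2 = Real.pi / 2 := by ring
  simp only [pansuChart, pansuPole, hw, h1, h2, pansuHeight, Real.cos_pi_div_two]
  refine Prod.ext (by simp) ?_
  simp only
  ring

/-- The chart is injective on the open ball and maps the sphere away from the image of the ball. -/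
theorem pansuChart_inj {σ lam c : ℝ} (hσ : σ = 1 ∨ σ = -1) (hlam : 0 < lam) {w w' : CVec n}
    (hw : ‖w‖ < Real.pi) (hw' : ‖w'‖ ≤ Real.pi)
    (h : pansuChart σ lam c w = pansuChart σ lam c w') : w = w' := by
  have hσ0 : σ ≠ 0 := by rcases hσ with rfl | rfl <;> norm_num
  have h1 : (pansuChart σ lam c w).1 = (pansuChart σ lam c w').1 := by rw [h]
  have h2 : (pansuChart σ lam c w).2 = (pansuChart σ lam c w').2 := by rw [h]
  have hl2 : (1 / (2 * lam ^ 2)) ≠ 0 := by positivity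
  have hnn := norm_nonneg w
  have hnn' := norm_nonneg w'
  have h3 : ‖w‖ = ‖w'‖ := by
    have h4 : pansuHeight (‖w‖ - Real.pi / 2) = pansuHeight (‖w'‖ - Real.pi / 2) := by
      simpa only [pansuChart, add_right_inj, mul_right_inj' hσ0, mul_right_inj' hl2] using h2
    have := strictMonoOn_pansuHeight.injOn ⟨by linarith, by linarith⟩
      ⟨by linarith, by linarith⟩ h4
    linarith
  by_cases h0 : ‖w‖ = 0
  · rw [norm_eq_zero.1 h0, norm_eq_zero.1 (h3.symm.trans h0)]
  · have h5 : Real.sinc ‖w‖ / lam ≠ 0 := by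
      rw [Real.sinc_of_ne_zero h0]
      have h6 : 0 < ‖w‖ := lt_of_le_of_ne hnn (Ne.symm h0)
      have := Real.sin_pos_of_pos_of_lt_pi h6 hw
      positivity
    simp only [pansuChart, ← h3] at h1
    exact smul_right_injective _ h5 h1

theorem exists_norm_eq (hn : 1 ≤ n) {r : ℝ} (hr : 0 ≤ r) (z : CVec n) :
    ∃ w : CVec n, ‖w‖ = r ∧ ‖z‖ • w = r • z := by
  by_cases hz : z = 0
  · refine ⟨r • EuclideanSpace.single ⟨0, hn⟩ 1, ?_, by simp [hz]⟩
    rw [norm_smul]; simp [abs_of_nonneg hr]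
  · have h0 : ‖z‖ ≠ 0 := norm_ne_zero_iff.2 hz
    refine ⟨(r / ‖z‖) • z, ?_, ?_⟩
    · rw [norm_smul, Real.norm_of_nonneg (by positivity), div_mul_cancel₀ _ h0]
    · rw [smul_smul, mul_div_cancel₀ _ h0]

theorem image_pansuChart (hn : 1 ≤ n) {σ lam c : ℝ} (hσ : σ = 1 ∨ σ = -1) (hlam : 0 < lam) :
    pansuChart σ lam c '' Metric.closedBall (0 : CVec n) Real.pi =
      vertTranslate c '' pansuSphere n lam := by
  apply Set.Subset.antisymm
  · rintro _ ⟨w, hw, rfl⟩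
    exact pansuChart_mem hσ hlam (mem_closedBall_zero_iff.1 hw)
  · rintro ⟨z, t⟩ hq
    rw [mem_vertTranslate_pansuSphere] at hq
    obtain ⟨hz, ht⟩ := hq
    simp only at hz ht
    rw [le_div_iff₀ hlam] at hz
    have hl0 : 0 ≤ lam * ‖z‖ := by positivity
    have hl1 : lam * ‖z‖ ≤ 1 := by linarith
    rw [pansuProfile_eq hl0 hl1] at ht
    -- The latitude is `± arccos(λ|z|)`, with the sign fixed by the half of the sphere and by `σ`.
    obtain ⟨θ, hθ, hcos, hθt⟩ : ∃ θ ∈ Set.Icc (-(Real.pi / 2)) (Real.pi / 2),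
        Real.cos θ = lam * ‖z‖ ∧ t - c = σ * (1 / (2 * lam ^ 2) * pansuHeight θ) := by
      have ha0 := Real.arccos_nonneg (lam * ‖z‖)
      have ha1 := Real.arccos_le_pi_div_two.2 hl0
      have hca : Real.cos (Real.arccos (lam * ‖z‖)) = lam * ‖z‖ :=
        Real.cos_arccos (by linarith) hl1
      have hpos : ∃ θ ∈ Set.Icc (-(Real.pi / 2)) (Real.pi / 2),
          Real.cos θ = lam * ‖z‖ ∧ pansuHeight θ = pansuHeight (Real.arccos (lam * ‖z‖)) :=
        ⟨_, ⟨by linarith, ha1⟩, hca, rfl⟩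
      have hneg : ∃ θ ∈ Set.Icc (-(Real.pi / 2)) (Real.pi / 2),
          Real.cos θ = lam * ‖z‖ ∧ pansuHeight θ = -pansuHeight (Real.arccos (lam * ‖z‖)) :=
        ⟨-Real.arccos (lam * ‖z‖), ⟨by linarith, by linarith⟩, by rw [Real.cos_neg, hca],
          pansuHeight_neg _⟩
      rcases ht with ht | ht <;> rcases hσ with rfl | rfl
      · obtain ⟨θ, h1, h2, h3⟩ := hpos
        exact ⟨θ, h1, h2, by rw [ht, h3]; ring⟩
      · obtain ⟨θ, h1, h2, h3⟩ := hneg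
        exact ⟨θ, h1, h2, by rw [ht, h3]; ring⟩
      · obtain ⟨θ, h1, h2, h3⟩ := hneg
        exact ⟨θ, h1, h2, by rw [ht, h3]; ring⟩
      · obtain ⟨θ, h1, h2, h3⟩ := hpos
        exact ⟨θ, h1, h2, by rw [ht, h3]; ring⟩
    have hτ0 : 0 ≤ θ + Real.pi / 2 := by linarith [hθ.1]
    obtain ⟨w, hw, hwz⟩ := exists_norm_eq hn hτ0 z
    refine ⟨w, mem_closedBall_zero_iff.2 (by rw [hw]; linarith [hθ.2]), ?_⟩
    have h1 : Real.sin ‖w‖ = lam * ‖z‖ := by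
      rw [hw, Real.sin_add_pi_div_two, hcos]
    refine Prod.ext ?_ ?_
    · change (Real.sinc ‖w‖ / lam) • w = z
      by_cases h0 : ‖w‖ = 0
      · have hz0 : ‖z‖ = 0 := by
          rw [h0, Real.sin_zero] at h1
          exact (mul_eq_zero.1 h1.symm).resolve_left hlam.ne'
        rw [norm_eq_zero.1 h0, norm_eq_zero.1 hz0, smul_zero]
      · rw [Real.sinc_of_ne_zero h0, h1]
        have h2 : lam * ‖z‖ / ‖w‖ / lam = ‖w‖⁻¹ * ‖z‖ := by field_simp
        rw [h2, mul_smul, hwz, ← hw, inv_smul_smul₀ h0]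
    · change c + σ * (1 / (2 * lam ^ 2) * pansuHeight (‖w‖ - Real.pi / 2)) = t
      rw [hw, add_sub_cancel_right, ← hθt]
      ring

theorem isConnected_pansuSphere (hn : 1 ≤ n) {lam : ℝ} (hlam : 0 < lam) (c : ℝ) :
    IsConnected (vertTranslate c '' pansuSphere n lam) := by
  rw [← image_pansuChart hn (σ := 1) (Or.inl rfl) hlam]
  exact (Metric.isConnected_closedBall Real.pi_pos.le).image _ (continuous_pansuChart _ _ _).continuousOn

/-- The chart as a map from the open ball to the sphere. -/
def pansuChartBall {σ lam : ℝ} (c : ℝ) (hσ : σ = 1 ∨ σ = -1) (hlam : 0 < lam)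
    (w : Metric.ball (0 : CVec n) Real.pi) : vertTranslate c '' pansuSphere n lam :=
  ⟨pansuChart σ lam c (w : CVec n), pansuChart_mem hσ hlam (mem_ball_zero_iff.1 w.2).le⟩

/-- The complement of an open set in the closed ball is compact, so its image is closed. Injectivity
of the chart between open and closed ball makes this image the complement, in the sphere, of the
image of the open set. -/
theorem isOpenEmbedding_pansuChartBall (hn : 1 ≤ n) {σ lam : ℝ} (c : ℝ) (hσ : σ = 1 ∨ σ = -1)
    (hlam : 0 < lam) : Topology.IsOpenEmbedding (pansuChartBall (n := n) c hσ hlam) := by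
  refine .of_continuous_injective_isOpenMap ?_ ?_ ?_
  · exact ((continuous_pansuChart σ lam c).comp continuous_subtype_val).subtype_mk _
  · intro w w' h
    exact Subtype.ext (pansuChart_inj hσ hlam (mem_ball_zero_iff.1 w.2)
      (mem_ball_zero_iff.1 w'.2).le (congr_arg Subtype.val h))
  · intro U hU
    obtain ⟨U₀, hU₀, rfl⟩ := isOpen_induced_iff.1 hU
    set C := Metric.closedBall (0 : CVec n) Real.pi \ (U₀ ∩ Metric.ball 0 Real.pi) with hC
    have hCc : IsCompact C :=
      (isCompact_closedBall _ _).diff (hU₀.inter Metric.isOpen_ball)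
    have hcl : IsClosed (pansuChart σ lam c '' C) :=
      (hCc.image (continuous_pansuChart σ lam c)).isClosed
    have : pansuChartBall (n := n) c hσ hlam '' (Subtype.val ⁻¹' U₀) =
        Subtype.val ⁻¹' (pansuChart σ lam c '' C)ᶜ := by
      ext ⟨q, hq⟩
      constructor
      · rintro ⟨w, hwU, hwq⟩
        have hwq' : pansuChart σ lam c (w : CVec n) = q := congr_arg Subtype.val hwq
        rintro ⟨w', ⟨hw', hw'U⟩, hww⟩
        have := pansuChart_inj hσ hlam (mem_ball_zero_iff.1 w.2) (mem_closedBall_zero_iff.1 hw')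
          (hwq'.trans hww.symm)
        exact hw'U (this ▸ ⟨hwU, w.2⟩)
      · intro h
        rw [← image_pansuChart hn hσ hlam] at hq
        obtain ⟨w, hw, rfl⟩ := hq
        have h1 : w ∈ U₀ ∩ Metric.ball 0 Real.pi := by
          by_contra hc
          exact h ⟨w, ⟨hw, hc⟩, rfl⟩
        exact ⟨⟨w, h1.2⟩, h1.1, rfl⟩
    rw [this]
    exact hcl.isOpen_compl.preimage continuous_subtype_val

theorem mem_range_pansuChartBall (hn : 1 ≤ n) {σ lam : ℝ} {c : ℝ} (hσ : σ = 1 ∨ σ = -1)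
    (hlam : 0 < lam) (q : vertTranslate c '' pansuSphere n lam)
    (hq : (q : Heis n) ≠ pansuPole n σ lam c) :
    q ∈ Set.range (pansuChartBall (n := n) c hσ hlam) := by
  obtain ⟨q, hqS⟩ := q
  have hqS' := hqS
  rw [← image_pansuChart hn hσ hlam] at hqS'
  obtain ⟨w, hw, rfl⟩ := hqS'
  rcases (mem_closedBall_zero_iff.1 hw).lt_or_eq with h | h
  · exact ⟨⟨w, mem_ball_zero_iff.2 h⟩, rfl⟩
  · exact absurd (pansuChart_of_norm_eq_pi h) hq

end Heis

/-! ### Covering of the Pansu sphere by the hypersurface, and the inward normal -/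

namespace Heis

variable {n : ℕ} {M : Type*} [TopologicalSpace M]

theorem abs_sub_eq_of_mem_pansuSphere {lam c : ℝ} (hlam : 0 < lam) {q : Heis n}
    (hq : q ∈ vertTranslate c '' pansuSphere n lam) : |q.2 - c| = pansuProfile lam ‖q.1‖ := by
  obtain ⟨-, h2⟩ := mem_vertTranslate_pansuSphere.1 hq
  have := pansuProfile_nonneg hlam (norm_nonneg q.1)
  rcases h2 with h2 | h2
  · rw [h2, abs_of_nonneg this]
  · rw [h2, abs_neg, abs_of_nonneg this]

/-- Two points of a Pansu sphere at the same height are at the same distance from the axis. -/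
theorem norm_fst_eq_of_mem_pansuSphere {lam c : ℝ} (hlam : 0 < lam) {q q' : Heis n}
    (hq : q ∈ vertTranslate c '' pansuSphere n lam)
    (hq' : q' ∈ vertTranslate c '' pansuSphere n lam) (h : q.2 = q'.2) : ‖q.1‖ = ‖q'.1‖ :=
  (strictAntiOn_pansuProfile hlam).injOn
    ⟨norm_nonneg _, (mem_vertTranslate_pansuSphere.1 hq).1⟩
    ⟨norm_nonneg _, (mem_vertTranslate_pansuSphere.1 hq').1⟩
    (by rw [← abs_sub_eq_of_mem_pansuSphere hlam hq, ← abs_sub_eq_of_mem_pansuSphere hlam hq', h])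

section Symmetric

variable [SecondCountableTopology M] {φ : M → Heis n} (hφ : IsImmersedHypersurface φ)
  (hrot : IsRotationallySymmetric φ) (hn : 1 ≤ n) {p : M} {lam c : ℝ}

include hφ hrot

/-- Since `κ² = λ² ≠ 0`, the normal always has a radial component, so the radial direction is
transversal off the axis. -/
theorem HasOsculatingSphere.radial_ne (hp : HasOsculatingSphere φ lam c p) (hlam : lam ≠ 0)
    (hz : (φ p).1 ≠ 0) {u : Heis n → ℝ} (hu : IsDefiningAt ∞ φ p u) : radial u (φ p) ≠ 0 := by
  obtain ⟨W, hpW, hW, -⟩ := hu.exists_isInfSymmetric hφ hrot hz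
  obtain ⟨u', hu', hk, -⟩ := hp
  have hone : (1 : WithTop ℕ∞) ≤ ∞ := by exact_mod_cast le_top
  rw [hu.kappaSq_eq hu' hone hone, kappaSq, hW.normalRad_eq hpW hu.apply_eq_zero] at hk
  intro h0
  rw [h0] at hk
  simp at hk
  exact hlam (by simpa using hk.symm)

include hn

/-- There is a direction transversal to the hypersurface, along which the Pansu sphere is
a graph. -/
theorem exists_transversal (hlam : 0 < lam)
    (hosc : ∀ p, (φ p).1 ≠ 0 → HasOsculatingSphere φ lam c p)
    (hmem : φ p ∈ vertTranslate c '' pansuSphere n lam) :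
    ∃ (u : Heis n → ℝ) (ν : Heis n) (ε : ℝ), IsDefiningAt 2 φ p u ∧ fderiv ℝ u (φ p) ν ≠ 0 ∧
      0 < ε ∧ ∀ᶠ x in 𝓝 (φ p), ∀ s : ℝ, |s| < ε → x ∈ vertTranslate c '' pansuSphere n lam →
        x + s • ν ∈ vertTranslate c '' pansuSphere n lam → s = 0 := by
  by_cases hz : (φ p).1 = 0
  · obtain ⟨u, hu⟩ := hφ.exists_defining p
    have hr : 0 < |(φ p).2 - c| := by
      rw [abs_sub_eq_of_mem_pansuSphere hlam hmem, hz, norm_zero, pansuProfile_zero]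
      have := Real.pi_pos
      positivity
    refine ⟨u, (0, 1), |(φ p).2 - c|, hu, hu.fderiv_vert_ne hφ hrot hn (by norm_num) hz, hr, ?_⟩
    have hev : ∀ᶠ x in 𝓝 (φ p), |(φ p).2 - c| / 2 < |x.2 - c| := by
      have h1 : Filter.Tendsto (fun x : Heis n => |x.2 - c|) (𝓝 (φ p)) (𝓝 |(φ p).2 - c|) :=
        Continuous.tendsto (by fun_prop) _
      exact h1.eventually (lt_mem_nhds (by linarith))
    -- On a vertical line the other point of the sphere is the mirror image at height `c`, at
    -- distance `2|x.2 - c| > ε`.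
    filter_upwards [hev] with x hx s hs hxS hxsS
    have h1 := abs_sub_eq_of_mem_pansuSphere hlam hxS
    have h2 := abs_sub_eq_of_mem_pansuSphere hlam hxsS
    have h3 : (x + s • ((0 : CVec n), (1 : ℝ))).1 = x.1 := by simp
    have h4 : (x + s • ((0 : CVec n), (1 : ℝ))).2 = x.2 + s := by simp
    rw [h3, h4, ← h1] at h2
    rcases abs_eq_abs.1 h2 with h5 | h5
    · linarith
    · exfalso
      have h6 : s = -(2 * (x.2 - c)) := by linarith
      rw [h6, abs_neg, abs_mul, abs_two] at hs
      linarith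
  · obtain ⟨u, hu⟩ := exists_smooth_defining_of_ne_zero hφ hrot hn hz
    have hρ := levi_self_pos hz
    have hA := (hosc p hz).radial_ne hφ hrot hlam.ne' hz hu
    refine ⟨u, ((φ p).1, 0), 1, hu.of_le (WithTop.coe_le_coe.2 (le_top : (2 : ℕ∞) ≤ ⊤)),
      fun h0 => hA (by rw [radial, h0, zero_div]), one_pos, ?_⟩
    have hev : ∀ᶠ x in 𝓝 (φ p), levi (φ p).1 (φ p).1 / 2 < levi (φ p).1 x.1 := by
      have h1 : Filter.Tendsto (fun x : Heis n => levi (φ p).1 x.1) (𝓝 (φ p))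
          (𝓝 (levi (φ p).1 (φ p).1)) :=
        (((leviL (φ p).1).continuous.comp continuous_fst).tendsto (φ p))
      exact h1.eventually (lt_mem_nhds (by linarith))
    -- The shift keeps the height, which determines `|z|` on the sphere; the resulting quadratic in
    -- `s` has no other root in `(-1, 1)`.
    filter_upwards [hev] with x hx s hs hxS hxsS
    have h1 := norm_fst_eq_of_mem_pansuSphere hlam hxS hxsS (by simp)
    have h2 : (x + s • ((φ p).1, (0 : ℝ))).1 = x.1 + s • (φ p).1 := by simp
    have h3 : levi x.1 x.1 = levi (x.1 + s • (φ p).1) (x.1 + s • (φ p).1) := by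
      rw [levi_self, levi_self, ← h2, h1]
    simp only [levi_add_left, levi_add_right, levi_smul_left, levi_smul_right,
      levi_comm x.1 (φ p).1] at h3
    have h4 : s * (2 * levi (φ p).1 x.1 + s * levi (φ p).1 (φ p).1) = 0 := by linarith
    refine (mul_eq_zero.1 h4).resolve_right fun h5 => ?_
    have := (abs_lt.1 hs).1
    nlinarith

/-- The image of every neighbourhood is a neighbourhood in the Pansu sphere. -/
theorem eventually_mem_image (hlam : 0 < lam)
    (hosc : ∀ p, (φ p).1 ≠ 0 → HasOsculatingSphere φ lam c p)
    (hmem : ∀ p, φ p ∈ vertTranslate c '' pansuSphere n lam) {N : Set M} (hN : N ∈ 𝓝 p) :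
    ∀ᶠ x in 𝓝 (φ p), x ∈ vertTranslate c '' pansuSphere n lam → x ∈ φ '' N := by
  obtain ⟨u, ν, ε, hu, hν, hε, hev⟩ := exists_transversal hφ hrot hn hlam hosc (hmem p)
  have hudiff : ContDiffAt ℝ 1 u (φ p) := hu.contDiffAt.of_le (by norm_num)
  let G : Heis n × ℝ → Heis n := fun y => y.1 + y.2 • ν
  have hGc : Continuous G := by fun_prop
  have hG0 : G (φ p, 0) = φ p := by simp [G]
  have hGt : Filter.Tendsto G (𝓝 (φ p, 0)) (𝓝 (φ p)) := by
    have := hGc.tendsto (φ p, 0)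
    rwa [hG0] at this
  have hcont : ∀ᶠ y in 𝓝 (φ p, (0 : ℝ)), ContinuousAt (fun y => u (G y)) y := by
    have h1 : ∀ᶠ x in 𝓝 (φ p), ContinuousAt u x :=
      (hudiff.eventually (by simp)).mono fun x hx => hx.continuousAt
    filter_upwards [hGt.eventually h1] with y hy
    exact ContinuousAt.comp (f := G) hy hGc.continuousAt
  have hder : HasDerivAt (fun s => u (G (φ p, s))) (fderiv ℝ u (φ p) ν) 0 := by
    have h1 : HasDerivAt (fun s => G (φ p, s)) ν 0 := by
      exact (((hasDerivAt_id (0 : ℝ)).smul_const ν).const_add (φ p)).congr_deriv (one_smul ℝ ν)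
    have h3 : HasFDerivAt u (fderiv ℝ u (φ p)) (G (φ p, 0)) := by
      rw [hG0]; exact (hudiff.differentiableAt (by norm_num)).hasFDerivAt
    exact h3.comp_hasDerivAt 0 h1
  have hrange := hGt.eventually (hu.eventually_exists_mem hN)
  rw [nhds_prod_eq] at hrange
  obtain ⟨pX, hpX, pR, hpR, hpq⟩ := Filter.eventually_prod_iff.1 hrange
  obtain ⟨δ, hδ, hball⟩ := Metric.eventually_nhds_iff_ball.1 hpR
  have hnear := eventually_exists_zero (F := fun y : Heis n × ℝ => u (G y)) hcont
    (by simp only [hG0]; exact hu.apply_eq_zero) hder hν (lt_min hε hδ)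
  filter_upwards [hnear, hpX, hev] with x hx hxX hxev hxS
  obtain ⟨s, hs, hs0⟩ := hx
  obtain ⟨y, hyN, hy⟩ := hpq hxX (hball s (by
    simpa [Real.norm_eq_abs] using hs.trans_le (min_le_right _ _))) hs0
  -- Both `x` and the nearby zero of `u` lie on the sphere and on one transversal line, so they
  -- coincide.
  have hs' : s = 0 := hxev s (hs.trans_le (min_le_left _ _)) hxS (by
    change G (x, s) ∈ _
    rw [← hy]
    exact hmem y)
  refine ⟨y, hyN, ?_⟩
  rw [hy, hs']
  simp [G]

/-- An immersed closed hypersurface in a Pansu sphere is the whole sphere, and is embedded. -/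
theorem range_eq_and_injective [T2Space M] [CompactSpace M] [ConnectedSpace M] (hlam : 0 < lam)
    (hosc : ∀ p, (φ p).1 ≠ 0 → HasOsculatingSphere φ lam c p)
    (hmem : ∀ p, φ p ∈ vertTranslate c '' pansuSphere n lam) :
    Set.range φ = vertTranslate c '' pansuSphere n lam ∧ Function.Injective φ := by
  have hcont := hφ.continuous
  let Φ : M → vertTranslate c '' pansuSphere n lam := fun x => ⟨φ x, hmem x⟩
  have hΦc : Continuous Φ := hcont.subtype_mk _
  have hΦopen : IsOpenMap Φ := by
    rw [isOpenMap_iff_nhds_le]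
    intro p N hN
    have h1 := eventually_mem_image hφ hrot hn hlam hosc hmem (Filter.mem_map.1 hN)
    rw [nhds_subtype, Filter.mem_comap]
    refine ⟨_, h1, fun x hx => ?_⟩
    obtain ⟨y, hy, hyx⟩ := hx x.2
    have : Φ y = x := Subtype.ext hyx
    rw [← this]
    exact hy
  have hlocal : IsLocalHomeomorph Φ := by
    rw [isLocalHomeomorph_iff_isOpenEmbedding_restrict]
    intro p
    obtain ⟨u, hu⟩ := hφ.exists_defining p
    obtain ⟨V, hV, hinj⟩ := hu.exists_injOn
    refine ⟨interior V, interior_mem_nhds.2 hV, ?_⟩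
    refine .of_continuous_injective_isOpenMap (hΦc.comp continuous_subtype_val) ?_
      (hΦopen.comp isOpen_interior.isOpenMap_subtype_val)
    rintro ⟨x, hx⟩ ⟨y, hy⟩ hxy
    exact Subtype.ext (hinj (interior_subset hx) (interior_subset hy) (congr_arg Subtype.val hxy))
  -- A local homeomorphism from a compact space to a Hausdorff space is a covering.
  have hcov : IsCoveringMap Φ := isLocalHomeomorph_iff_isCoveringMap.1 hlocal
  have hconn : ConnectedSpace (vertTranslate c '' pansuSphere n lam) :=
    isConnected_iff_connectedSpace.1 (isConnected_pansuSphere hn hlam c)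
  have hsurj : Set.range Φ = Set.univ :=
    IsClopen.eq_univ ⟨(isCompact_range hΦc).isClosed, hΦopen.isOpen_range⟩ (Set.range_nonempty Φ)
  refine ⟨Set.Subset.antisymm (Set.range_subset_iff.2 hmem) fun q hq => ?_, ?_⟩
  · have : (⟨q, hq⟩ : vertTranslate c '' pansuSphere n lam) ∈ Set.range Φ :=
      hsurj ▸ Set.mem_univ _
    obtain ⟨x, hx⟩ := this
    exact ⟨x, congr_arg Subtype.val hx⟩
  have hinj : ∀ σ : ℝ, σ = 1 ∨ σ = -1 → ∀ x y, φ x ≠ pansuPole n σ lam c → φ x = φ y →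
      x = y := by
    intro σ hσ x y hx hxy
    have : ContractibleSpace (Metric.ball (0 : CVec n) Real.pi) :=
      Metric.contractibleSpace_ball Real.pi_pos
    have : LocallyPathConnectedSpace (Metric.ball (0 : CVec n) Real.pi) :=
      Metric.isOpen_ball.locallyPathConnectedSpace
    refine hcov.injOn_preimage_range (isOpenEmbedding_pansuChartBall hn c hσ hlam)
      (fun p N hN => ?_) (fun p hp => ?_) (mem_range_pansuChartBall hn hσ hlam (Φ x) hx)
      (mem_range_pansuChartBall hn hσ hlam (Φ y) fun h => hx (hxy.trans h)) (Subtype.ext hxy)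
    · obtain ⟨u, hu⟩ := hφ.exists_defining p
      exact hu.exists_isConnected_diff hn (by norm_num) hN
    · have hpole : φ p = pansuPole n σ lam c := by
        by_contra hne
        exact hp (mem_range_pansuChartBall hn hσ hlam (Φ p) hne)
      have hz : (φ p).1 = 0 := by rw [hpole]; rfl
      filter_upwards [eventually_fst_ne_zero hφ hrot hn hz] with x hx
      refine mem_range_pansuChartBall hn hσ hlam (Φ x) fun h => hx ?_
      rw [show φ x = pansuPole n σ lam c from h]
      rfl
  intro x y hxy
  by_cases hx : φ x = pansuPole n 1 lam c
  · refine hinj (-1) (Or.inr rfl) x y ?_ hxy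
    rw [hx]
    intro h
    have h1 := congr_arg Prod.snd h
    simp only [pansuPole] at h1
    have h2 : 0 < Real.pi / (4 * lam ^ 2) := by have := Real.pi_pos; positivity
    linarith
  · exact hinj 1 (Or.inl rfl) x y hx hxy

/-- With respect to the inward normal, the common eigenvalue is positive. -/
theorem isCommonEigenvalue_of_inward (hlam : 0 < lam)
    (hosc : ∀ p, (φ p).1 ≠ 0 → HasOsculatingSphere φ lam c p)
    (hmem : φ p ∈ vertTranslate c '' pansuSphere n lam) (hp : IsRegular φ p) {u : Heis n → ℝ}
    (hu : IsDefiningAt ∞ φ p u)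
    (hin : ∀ᶠ q in 𝓝 (φ p), q ∈ vertTranslate c '' pansuBall n lam → 0 < u q) :
    IsCommonEigenvalue u (φ p) lam := by
  have hz := (isRegular_iff hφ hrot hn).1 hp
  obtain ⟨W, hpW, hW, -⟩ := hu.exists_isInfSymmetric hφ hrot hz
  have hu0 := hu.apply_eq_zero
  have hρ := hW.levi_fst_pos hpW
  have hN := hW.norm_hgrad_pos hpW hu0
  have hone : (1 : WithTop ℕ∞) ≤ ∞ := by exact_mod_cast le_top
  have hk : kappaSq u (φ p) = lam ^ 2 := by
    obtain ⟨u', hu', hk, -⟩ := hosc p hz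
    rw [hu'.kappaSq_eq hu hone hone, hk]
  have hA : fderiv ℝ u (φ p) ((φ p).1, 0) ≤ 0 := by
    have hline : HasDerivAt (fun s : ℝ => φ p - s • ((φ p).1, (0 : ℝ)))
        (-((φ p).1, (0 : ℝ))) 0 := by
      simpa using ((hasDerivAt_id (0 : ℝ)).smul_const ((φ p).1, (0 : ℝ))).const_sub (φ p)
    have hd : HasDerivAt (fun s : ℝ => u (φ p - s • ((φ p).1, (0 : ℝ))))
        (-fderiv ℝ u (φ p) ((φ p).1, 0)) 0 := by
      have h1 : HasFDerivAt u (fderiv ℝ u (φ p)) (φ p - (0 : ℝ) • ((φ p).1, (0 : ℝ))) := by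
        rw [zero_smul, sub_zero]
        exact ((hW.contDiffAt_one hpW).differentiableAt (by norm_num)).hasFDerivAt
      have := h1.comp_hasDerivAt 0 hline
      rwa [map_neg] at this
    have hpos : ∀ᶠ s in 𝓝[>] (0 : ℝ), 0 < u (φ p - s • ((φ p).1, (0 : ℝ))) := by
      have ht : Filter.Tendsto (fun s : ℝ => φ p - s • ((φ p).1, (0 : ℝ))) (𝓝[>] 0)
          (𝓝 (φ p)) := by
        have := hline.continuousAt.tendsto
        rw [zero_smul, sub_zero] at this
        exact this.mono_left nhdsWithin_le_nhds
      have h01 : ∀ᶠ s in 𝓝[>] (0 : ℝ), s ∈ Set.Ioo (0 : ℝ) 1 := Ioo_mem_nhdsGT one_pos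
      filter_upwards [ht.eventually hin, h01] with s hs hs01
      -- Shrinking `z` at fixed height enters the enclosed domain, because the profile is strictly
      -- decreasing. Hence `u` does not increase in the outward radial direction, and `P ≤ 0`.
      refine hs ⟨((1 - s) • (φ p).1, (φ p).2 - c), ?_, ?_⟩
      · have hr : 0 < ‖(φ p).1‖ := norm_pos_iff.2 hz
        have hle := (mem_vertTranslate_pansuSphere.1 hmem).1
        have hn' : ‖(1 - s) • (φ p).1‖ = (1 - s) * ‖(φ p).1‖ := by
          rw [norm_smul, Real.norm_of_nonneg (by linarith [hs01.2])]
        have hlt : (1 - s) * ‖(φ p).1‖ < ‖(φ p).1‖ := by nlinarith [hs01.1]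
        have h0 : 0 ≤ (1 - s) * ‖(φ p).1‖ := mul_nonneg (by linarith [hs01.2]) hr.le
        refine ⟨by rw [hn']; linarith, ?_⟩
        simp only [hn', abs_sub_eq_of_mem_pansuSphere hlam hmem]
        exact strictAntiOn_pansuProfile hlam ⟨h0, by linarith⟩ ⟨hr.le, hle⟩ hlt
      · refine Prod.ext ?_ ?_
        · simp [vertTranslate, sub_smul]
        · simp [vertTranslate]
    have hle : 𝓝[>] (0 : ℝ) ≤ 𝓝[≠] 0 := nhdsWithin_mono _ fun x hx => ne_of_gt hx
    have hslope := hd.tendsto_slope.mono_left hle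
    have : 0 ≤ -fderiv ℝ u (φ p) ((φ p).1, 0) := by
      refine ge_of_tendsto hslope ?_
      filter_upwards [hpos, self_mem_nhdsWithin] with s hs hs0
      rw [slope_def_field, zero_smul, sub_zero, hu0, sub_zero, sub_zero]
      exact div_nonneg hs.le (le_of_lt hs0)
    linarith
  have hrad : radial u (φ p) ≤ 0 := div_nonpos_of_nonpos_of_nonneg hA hρ.le
  have hP : normalRad u (φ p) ≤ 0 := by
    rw [hW.normalRad_eq hpW hu0]
    exact div_nonpos_of_nonpos_of_nonneg (mul_nonpos_of_nonpos_of_nonneg hrad hρ.le) hN.le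
  have heq : lam = -(normalRad u (φ p) / levi (φ p).1 (φ p).1) := by
    have h1 : 0 ≤ -(normalRad u (φ p) / levi (φ p).1 (φ p).1) :=
      neg_nonneg.2 (div_nonpos_of_nonpos_of_nonneg hP hρ.le)
    rw [← sq_eq_sq₀ hlam.le h1, ← hk, kappaSq]
    ring
  rw [heq]
  exact hW.isCommonEigenvalue hpW hu0

end Symmetric

theorem vertTranslate_zero (q : Heis n) : vertTranslate 0 q = q := by simp [vertTranslate]

/-- A translated Pansu sphere which is symmetric under `t ↦ -t` is centred at the origin. -/
theorem eq_zero_of_symmetric (n : ℕ) {lam c : ℝ} (hlam : 0 < lam)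
    (h : ∀ q ∈ vertTranslate c '' pansuSphere n lam,
      (q.1, -q.2) ∈ vertTranslate c '' pansuSphere n lam) : c = 0 := by
  have hP : 0 < Real.pi / (4 * lam ^ 2) := by have := Real.pi_pos; positivity
  -- The sphere meets the axis exactly at its two poles; reflecting both forces `c = 0`.
  have hiff : ∀ t : ℝ, ((0 : CVec n), t) ∈ vertTranslate c '' pansuSphere n lam ↔
      t - c = Real.pi / (4 * lam ^ 2) ∨ t - c = -(Real.pi / (4 * lam ^ 2)) := by
    intro t
    rw [mem_vertTranslate_pansuSphere]
    simp only [norm_zero, pansuProfile_zero]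
    exact and_iff_right (by positivity)
  have h1 := (hiff _).1 (h _ ((hiff (c + Real.pi / (4 * lam ^ 2))).2 (Or.inl (by ring))))
  have h2 := (hiff _).1 (h _ ((hiff (c - Real.pi / (4 * lam ^ 2))).2 (Or.inr (by ring))))
  rcases h1 with h1 | h1 <;> rcases h2 with h2 | h2 <;> simp only at h1 h2 <;> linarith

end Heis

end

theorem proposition3p1 (n : ℕ) (hn : 2 ≤ n) {M : Type*} [TopologicalSpace M] [T2Space M]
    [SecondCountableTopology M] (φ : M → Heis n) (hφ : Heis.IsImmersedHypersurface φ)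
    (hrot : Heis.IsRotationallySymmetric φ) :
    Heis.IsUmbilic φ ∧
    (CompactSpace M → ConnectedSpace M → Heis.LEqTwoK φ →
      ∃ lam c : ℝ, 0 < lam ∧ Function.Injective φ ∧
        Set.range φ = Heis.vertTranslate c '' Heis.pansuSphere n lam ∧
        ((∀ q ∈ Set.range φ, (q.1, -q.2) ∈ Set.range φ) →
          Set.range φ = Heis.pansuSphere n lam) ∧
        ∀ p, Heis.IsRegular φ p → ∀ u : Heis n → ℝ, Heis.IsDefiningAt ∞ φ p u →
          (∀ᶠ q in 𝓝 (φ p), q ∈ Heis.vertTranslate c '' Heis.pansuBall n lam → 0 < u q) →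
          Heis.IsCommonEigenvalue u (φ p) lam) := by
  have hn1 : 1 ≤ n := by omega
  refine ⟨Heis.isUmbilic_of_isRotationallySymmetric hφ hrot hn1, fun _ _ hl => ?_⟩
  obtain ⟨lam, c, hlam, hosc, hmem⟩ := Heis.exists_hasOsculatingSphere hφ hrot hn1 hl
  obtain ⟨hrange, hinj⟩ := Heis.range_eq_and_injective hφ hrot hn1 hlam hosc hmem
  refine ⟨lam, c, hlam, hinj, hrange, fun hsymm => ?_, fun p hp u hu hin =>
    Heis.isCommonEigenvalue_of_inward hφ hrot hn1 hlam hosc (hmem p) hp hu hin⟩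
  rw [hrange] at hsymm ⊢
  rw [Heis.eq_zero_of_symmetric n hlam hsymm]
  exact (Set.image_congr fun q _ => Heis.vertTranslate_zero q).trans (Set.image_id' _)
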